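/- Let $R$ be a countable Boolean ring (not necessarily with identity), let $X$ be its Stone space, and identify $R$ with the ring of compact open subsets of $X$. For a closed set $C\subseteq X$ let $I(C)=\{a\in R\mid a\cap C=\emptyset\}$ be the corresponding ideal. Let $P$ be a PO system, i.e. a (possibly infinite) set with an anti-symmetric transitive relation $<$ (where $p<p$ is allowed), and let $\{X_p\mid p\in P\}$ be a complete $P$-partition of $X$: the $X_p$ are non-empty, pairwise disjoint, cover $X$, and the derived set $X_p'$ (the set of limit points of $X_p$ in $X$) equals $\bigcup_{q<p}X_q$ for every $p\in P$. Call $\{X_p\}$ finite-crowded if it is a finite partition and each $X_p$ is either finite or has no isolated points (in itself). Regard $M=(R,\{I(\overline{X_p})\mid p\in P\})$ as a first-order structure in the language with $0,+,\cdot$ and one unary predicate for each $p\in P$, naming the ideal $I(\overline{X_p})$. Then: (a) if $P$ is countable (so that the language is countable), $M$ is $\omega$-categorical, i.e. every countable structure elementarily equivalent to $M$ is isomorphic to $M$, if and only if $\{X_p\}$ is finite-crowded; (b) for $P$ of any cardinality, the automorphism group of $M$ has only finitely many orbits on $R^r$ for every $r\ge 0$ if and only if $\{X_p\}$ is finite-crowded.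 -/

import Mathlib

open FirstOrder Set Topology

universe u v

/-! ### PO systems and partitions of a topological space -/

/-- A PO system is a set with an anti-symmetric transitive relation (`lt p p` is allowed). -/
structure IsPOSystem {P : Type v} (lt : P → P → Prop) : Prop where
  antisymm : ∀ p q, lt p q → lt q p → p = q
  trans : ∀ p q r, lt p q → lt q r → lt p r

/-- `{A p | p : P}` is a complete `P`-partition of `X`: the sets `A p` are non-empty, pairwise
disjoint and cover `X`, and the derived set of `A p` is the union of the `A q` with `q < p`. -/
structure IsCompletePartition {P : Type v} (lt : P → P → Prop) {X : Type u} [TopologicalSpace X]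
    (A : P → Set X) : Prop where
  nonempty : ∀ p, (A p).Nonempty
  disjoint : ∀ p q, p ≠ q → Disjoint (A p) (A q)
  cover : ⋃ p, A p = univ
  derived : ∀ p, derivedSet (A p) = ⋃ q ∈ {q | lt q p}, A q

/-- A family of subsets is finite-crowded if it is finite and each member is either finite or
crowded, i.e. without isolated points (Mathlib's `Preperfect`). -/
def IsFiniteCrowded {X : Type u} [TopologicalSpace X] (S : Set (Set X)) : Prop :=
  S.Finite ∧ ∀ B ∈ S, B.Finite ∨ Preperfect B

/-! ### The Stone space of a Boolean ring, possibly without identity -/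

/-- The points of the Stone space of a Boolean ring `R`: the non-zero ring homomorphisms from `R`
to the two-element field (equivalently, by taking kernels, the prime ideals of `R`). -/
def StoneSpace (R : Type u) [NonUnitalRing R] : Type u :=
  {f : R →ₙ+* ZMod 2 // f ≠ 0}

namespace StoneSpace

variable {R : Type u} [NonUnitalRing R]

/-- The compact open subset of the Stone space that corresponds to `a`. -/
def basicOpen (a : R) : Set (StoneSpace R) := {x | x.1 a = 1}

/-- The Stone topology, with the sets `basicOpen a` as a base. -/
instance instTopologicalSpace : TopologicalSpace (StoneSpace R) :=
  TopologicalSpace.generateFrom (Set.range (basicOpen (R := R)))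

/-- The ideal `I(C)` of all `a` whose compact open set is disjoint from `C`. -/
def idealOf (C : Set (StoneSpace R)) : Set R := {a | Disjoint (basicOpen a) C}

end StoneSpace

/-! ### Boolean rings with distinguished ideals as first-order structures -/

/-- The function symbols `0`, `+`, `*`. -/
inductive RngFunc : ℕ → Type
  | zero : RngFunc 0
  | add : RngFunc 2
  | mul : RngFunc 2

/-- One unary relation symbol for each `p : P`. -/
inductive IdealRel (P : Type v) : ℕ → Type v
  | mem (p : P) : IdealRel P 1

/-- The language of rings (without a symbol for `1`) with `P`-indexed unary predicates. -/
def idealLanguage (P : Type v) : FirstOrder.Language.{0, v} := ⟨RngFunc, IdealRel P⟩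

/-- The system `(R, {J p | p : P})`, as a type synonym of `R`. -/
def IdealSystem {P : Type v} (R : Type u) (_J : P → Set R) : Type u := R

/-- The system `(R, {J p | p : P})` as a first-order structure. -/
instance IdealSystem.instStructure {P : Type v} {R : Type u} [NonUnitalRing R] (J : P → Set R) :
    (idealLanguage P).Structure (IdealSystem R J) where
  funMap {_n} f := match f with
    | .zero => fun _ => (0 : R)
    | .add => fun x : Fin 2 → R => x 0 + x 1
    | .mul => fun x : Fin 2 → R => x 0 * x 1
  RelMap {_n} r := match r with
    | .mem p => fun x : Fin 1 → R => x 0 ∈ J p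

/-! ### Countable categoricity -/

/-- A (countable) structure `M` is `ω`-categorical if it is determined up to isomorphism, among the
countable structures for its language, by its first-order properties. -/
def IsOmegaCategorical (L : FirstOrder.Language.{0, v}) (M : Type u) [L.Structure M] : Prop :=
  ∀ (N : Type u) [L.Structure N], Countable N → L.ElementarilyEquivalent M N →
    Nonempty (M ≃[L] N)

/-- The automorphism group of `M` has only finitely many orbits on `M ^ r`: there is a finite set
of `r`-tuples such that each `r`-tuple is the image of one of them under an automorphism. -/
def IsAlmostTransitive (L : FirstOrder.Language.{0, v}) (M : Type u) [L.Structure M] (r : ℕ) :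
    Prop :=
  ∃ S : Set (Fin r → M), S.Finite ∧
    ∀ a : Fin r → M, ∃ b ∈ S, ∃ α : M ≃[L] M, ∀ i, α (b i) = a i

/-!
The middle term between the three conditions is that `M` realizes only finitely many complete types
of elements.

*Finite-crowded partitions give finitely many orbits.* For a tuple of compact open sets, consider
the cells of the Boolean algebra it generates, and count the points of each part `A p` in each cell.
In a finite-crowded partition such a count is bounded by the size of `A p` or is `0` or `⊤`, so
there are finitely many patterns of counts, and it remains to show that two tuples with the same
pattern (`StoneSpace.Alike`) are conjugate under an automorphism. This is a back-and-forth argument.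
Its extension step (`StoneSpace.exists_split`) rests on two facts: for a finite partition the union
of the parts over an upper set of `P` is open, and a crowded part meets an open set in no or in
infinitely many points. So after choosing finitely many witnesses, all other points of a cell can
be distributed freely by separating compact sets from closed ones. The only cell that need not be
compact lies outside all sets of the tuple; a compact open set is cut out of it outside which only
the parts occur that are not contained in any compact set (`StoneSpace.exists_minimal_residue`).

*Finitely many types give finite-crowded partitions.* The set of the compact open `a` that meet
`A p` is definable and determines `p`, by the antisymmetry of `<`, so `P` is finite. A part with
`p < p` is crowded, and otherwise `A p` contains none of its limit points. In the latter case
`n ≤ |a ∩ A p|` is a first-order property of `a` (`StoneSpace.countFormula`), and if `A p` were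
infinite, all natural numbers would occur as `|a ∩ A p|`.

*Countable categoricity.* Both directions of the Ryll-Nardzewski theorem are proved here, as far as
they are needed. If there are finitely many types in each finite set of variables, they are
isolated, and a back-and-forth argument applies. Conversely, a countable `ω`-categorical structure
`M` is isomorphic to a countable elementary substructure of its ultrapower, so it realizes each
countable partial type that is finitely satisfiable in it. This makes isolated tuples dense, hence
one can build a countable elementary substructure of `M` that consists of components of isolated
tuples. It is isomorphic to `M`, thus every element of `M` is isolated, and finitely many isolating
formulas must cover `M`.
-/

universe w

/-! ### Back-and-forth -/

/-- The back-and-forth method for countable sets `M` and `N`: a class `Q` of finite partial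
bijections with the extension property in both directions contains, for some bijection `M ≃ N`
that extends a given member of `Q`, all finite restrictions of that bijection. -/
theorem exists_equiv_of_back_and_forth {M : Type u} {N : Type w} [Countable M] [Countable N]
    [DecidableEq M] [DecidableEq N]
    (Q : Finset (M × N) → Prop) (mono : ∀ F G, Q F → G ⊆ F → Q G)
    (inj : ∀ F, Q F → ∀ x ∈ F, ∀ y ∈ F, x.1 = y.1 ↔ x.2 = y.2)
    (forth : ∀ F, Q F → ∀ m, ∃ n, Q (insert (m, n) F))
    (back : ∀ F, Q F → ∀ n, ∃ m, Q (insert (m, n) F))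
    (F₀ : Finset (M × N)) (h₀ : Q F₀) :
    ∃ e : M ≃ N, (∀ x ∈ F₀, e x.1 = x.2) ∧
      ∀ F : Finset M, Q (F.image fun m => (m, e m)) := by
  classical
  obtain ⟨_⟩ := nonempty_encodable M
  obtain ⟨_⟩ := nonempty_encodable N
  let S := {F : Finset (M × N) // Q F}
  let 𝒟 : M ⊕ N → Order.Cofinal S := fun i =>
    { carrier := {F | ∃ x ∈ F.1, Sum.elim (fun m => x.1 = m) (fun n => x.2 = n) i}
      isCofinal := by
        rintro ⟨F, hF⟩
        rcases i with m | n
        · obtain ⟨n, hn⟩ := forth F hF m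
          exact ⟨⟨_, hn⟩, ⟨(m, n), Finset.mem_insert_self _ _, rfl⟩, Finset.subset_insert _ _⟩
        · obtain ⟨m, hm⟩ := back F hF n
          exact ⟨⟨_, hm⟩, ⟨(m, n), Finset.mem_insert_self _ _, rfl⟩, Finset.subset_insert _ _⟩ }
  let I := Order.idealOfCofinals (⟨F₀, h₀⟩ : S) 𝒟
  have hI₀ : (⟨F₀, h₀⟩ : S) ∈ I := Order.mem_idealOfCofinals _ _
  -- any finite set of pairs occurring in the generic ideal lies in one of its members
  have hdir : ∀ G : Finset (M × N), (∀ x ∈ G, ∃ F ∈ I, x ∈ F.1) → ∃ F ∈ I, G ⊆ F.1 := by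
    intro G
    induction G using Finset.induction_on with
    | empty => exact fun _ => ⟨_, hI₀, Finset.empty_subset _⟩
    | insert a G _ ih =>
      intro h
      obtain ⟨F, hF, hGF⟩ := ih fun x hx => h x (Finset.mem_insert_of_mem hx)
      obtain ⟨F', hF', haF'⟩ := h a (Finset.mem_insert_self _ _)
      obtain ⟨K, hK, h1, h2⟩ := I.directed F hF F' hF'
      exact ⟨K, hK, Finset.insert_subset (h2 haF') (hGF.trans h1)⟩
  have hl : ∀ m, ∃ n, ∃ F ∈ I, (m, n) ∈ F.1 := fun m => by
    obtain ⟨F, ⟨x, hx, h⟩, hFI⟩ := Order.cofinal_meets_idealOfCofinals (⟨F₀, h₀⟩ : S) 𝒟 (.inl m)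
    obtain rfl : x.1 = m := h
    exact ⟨x.2, F, hFI, hx⟩
  have hr : ∀ n, ∃ m, ∃ F ∈ I, (m, n) ∈ F.1 := fun n => by
    obtain ⟨F, ⟨x, hx, h⟩, hFI⟩ := Order.cofinal_meets_idealOfCofinals (⟨F₀, h₀⟩ : S) 𝒟 (.inr n)
    obtain rfl : x.2 = n := h
    exact ⟨x.1, F, hFI, hx⟩
  choose f hf using hl
  choose g hg using hr
  have huniq : ∀ x y : M × N, (∃ F ∈ I, x ∈ F.1) → (∃ F ∈ I, y ∈ F.1) →
      (x.1 = y.1 ↔ x.2 = y.2) := by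
    intro x y hx hy
    obtain ⟨F, _, hF⟩ := hdir {x, y} (by
      intro z hz
      rcases Finset.mem_insert.1 hz with rfl | hz
      · exact hx
      · rwa [Finset.mem_singleton.1 hz])
    exact inj F.1 F.2 x (hF (by simp)) y (hF (by simp))
  refine ⟨⟨f, g, fun m => ?_, fun n => ?_⟩, fun x hx => ?_, fun F => ?_⟩
  · exact (huniq (g (f m), f m) (m, f m) (hg _) (hf _)).2 rfl
  · exact (huniq (g n, f (g n)) (g n, n) (hf _) (hg _)).1 rfl
  · exact (huniq (x.1, f x.1) x (hf _) ⟨_, hI₀, hx⟩).1 rfl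
  · obtain ⟨K, _, hK⟩ := hdir (F.image fun m => (m, f m)) (by
      intro x hx
      obtain ⟨m, _, rfl⟩ := Finset.mem_image.1 hx
      exact hf m)
    exact mono _ _ K.2 hK

/-! ### Finitely many types and countable categoricity -/

/-- Only finitely many complete types over `∅` in the variables `α` are realized in `M`. -/
def HasFinitelyManyTypes (L : FirstOrder.Language.{0, v}) (M : Type u) [L.Structure M]
    (α : Type w) : Prop :=
  ∃ S : Set (α → M), S.Finite ∧
    ∀ a : α → M, ∃ b ∈ S, ∀ φ : L.Formula α, φ.Realize b ↔ φ.Realize a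

theorem IsAlmostTransitive.hasFinitelyManyTypes {L : FirstOrder.Language.{0, v}} {M : Type u}
    [L.Structure M] (h : ∀ r, IsAlmostTransitive L M r) (α : Type w) [Finite α] :
    HasFinitelyManyTypes L M α := by
  obtain ⟨r, ⟨e⟩⟩ := Finite.exists_equiv_fin α
  obtain ⟨S, hS, h⟩ := h r
  refine ⟨(fun b => b ∘ e) '' S, hS.image _, fun a => ?_⟩
  obtain ⟨b, hb, σ, hσ⟩ := h (a ∘ e.symm)
  refine ⟨_, mem_image_of_mem _ hb, fun φ => ?_⟩
  have : a = σ ∘ (b ∘ e) := by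
    ext i
    simp [hσ]
  rw [this]
  exact (FirstOrder.Language.StrongHomClass.realize_formula σ φ).symm

/-- If `M` realizes finitely many types, then finitely many formulas isolate these types, and they
do so in each structure `N` elementarily equivalent to `M`. -/
theorem HasFinitelyManyTypes.exists_isolating {L : FirstOrder.Language.{0, v}} {M : Type u}
    [L.Structure M] {α : Type w} [Finite α] (h : HasFinitelyManyTypes L M α)
    {N : Type u} [L.Structure N]
    (hMN : L.ElementarilyEquivalent M N) :
    ∃ (ι : Type (max u w)) (χ : ι → L.Formula α), (∀ a : α → M, ∃ i, (χ i).Realize a) ∧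
      (∀ c : α → N, ∃ i, (χ i).Realize c) ∧
      ∀ i (a : α → M) (c : α → N), (χ i).Realize a → (χ i).Realize c →
        ∀ ψ : L.Formula α, ψ.Realize a ↔ ψ.Realize c := by
  classical
  obtain ⟨S, hS, h⟩ := h
  have hfin : Finite S := hS
  have hsep : ∀ b b' : S, ∃ ψ : L.Formula α, ψ.Realize b.1 ∧
      (ψ.Realize b'.1 → ∀ φ : L.Formula α, φ.Realize b.1 ↔ φ.Realize b'.1) := by
    intro b b'
    by_cases hbb : ∀ φ : L.Formula α, φ.Realize b.1 ↔ φ.Realize b'.1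
    · exact ⟨⊤, by simp, fun _ => hbb⟩
    · push Not at hbb
      obtain ⟨φ, ⟨h1, h2⟩ | ⟨h1, h2⟩⟩ := hbb
      · exact ⟨φ, h1, fun h3 => absurd h3 h2⟩
      · exact ⟨φ.not, by simpa using h1, fun h3 => absurd h2 (by simpa using h3)⟩
  -- `χ b` separates `b` from the other types, all of which occur in the finite set `S`
  choose ψ hψ1 hψ2 using hsep
  let χ : S → L.Formula α := fun b => FirstOrder.Language.Formula.iInf (ψ b)
  have hχ : ∀ (b : S) (a : α → M), (χ b).Realize a →
      ∀ φ : L.Formula α, φ.Realize b.1 ↔ φ.Realize a := by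
    intro b a ha φ
    obtain ⟨b', hb', hab⟩ := h a
    rw [FirstOrder.Language.Formula.realize_iInf] at ha
    exact (hψ2 b ⟨b', hb'⟩ ((hab _).2 (ha _)) φ).trans (hab φ)
  have hχself : ∀ b : S, (χ b).Realize b.1 := fun b => by
    rw [FirstOrder.Language.Formula.realize_iInf]
    exact hψ1 b
  -- formulas valid in `M` are valid in `N`, because their universal closures are sentences
  have hall : ∀ φ : L.Formula α, (∀ a : α → M, φ.Realize a) → ∀ c : α → N, φ.Realize c := by
    intro φ hφ
    let s : L.Sentence := (φ.relabel (Sum.inr : α → Empty ⊕ α)).iAlls α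
    have key : ∀ (K : Type u) [L.Structure K], K ⊨ s ↔ ∀ a : α → K, φ.Realize a := by
      intro K _
      simp only [s, FirstOrder.Language.Sentence.Realize, FirstOrder.Language.Formula.realize_iAlls,
        FirstOrder.Language.Formula.realize_relabel, Sum.elim_comp_inr]
    exact (key N).1 ((hMN.realize_sentence s).1 ((key M).2 hφ))
  refine ⟨S, χ, fun a => ?_, fun c => ?_, fun i a c ha hc φ => ?_⟩
  · obtain ⟨b, hb, hab⟩ := h a
    exact ⟨⟨b, hb⟩, (hab _).1 (hχself _)⟩
  · rw [← FirstOrder.Language.Formula.realize_iSup]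
    refine hall _ (fun a => ?_) c
    rw [FirstOrder.Language.Formula.realize_iSup]
    obtain ⟨b, hb, hab⟩ := h a
    exact ⟨⟨b, hb⟩, (hab _).1 (hχself _)⟩
  · have himp : ∀ θ : L.Formula α, θ.Realize a → θ.Realize c := by
      intro θ hθ
      have := hall ((χ i).imp θ) (fun a' => by
        rw [FirstOrder.Language.Formula.realize_imp]
        exact fun ha' => (hχ i a' ha' θ).1 ((hχ i a ha θ).2 hθ)) c
      rw [FirstOrder.Language.Formula.realize_imp] at this
      exact this hc
    refine ⟨himp φ, fun h1 => ?_⟩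
    by_contra h2
    have := himp φ.not (by simpa using h2)
    exact absurd h1 (by simpa using this)

/-- One direction of the Ryll-Nardzewski theorem: a countable structure that realizes finitely many
types in each finite set of variables is `ω`-categorical. -/
theorem isOmegaCategorical_of_hasFinitelyManyTypes {L : FirstOrder.Language.{0, v}} {M : Type u}
    [L.Structure M] [Countable M]
    (h : ∀ (α : Type u) [Finite α], HasFinitelyManyTypes L M α) : IsOmegaCategorical L M := by
  classical
  intro N _ _ hMN
  let Q : Finset (M × N) → Prop := fun F => ∀ φ : L.Formula F,
    φ.Realize (fun x => x.1.1) ↔ φ.Realize (fun x => x.1.2)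
  have hinsert : ∀ (F : Finset (M × N)) (m : M) (n : N),
      (∀ φ : L.Formula (F ⊕ Fin 1), φ.Realize (Sum.elim (fun x => x.1.1) fun _ => m) ↔
        φ.Realize (Sum.elim (fun x => x.1.2) fun _ => n)) → Q (insert (m, n) F) := by
    intro F m n hF φ
    let g : (insert (m, n) F : Finset (M × N)) → F ⊕ Fin 1 := fun x =>
      if hx : x.1 ∈ F then .inl ⟨x.1, hx⟩ else .inr 0
    have := hF (φ.relabel g)
    rw [FirstOrder.Language.Formula.realize_relabel,
      FirstOrder.Language.Formula.realize_relabel] at this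
    convert this using 2
    · ext x
      by_cases hx : x.1 ∈ F
      · simp [g, hx]
      · simp only [Function.comp_apply, show g x = .inr 0 from dif_neg hx, Sum.elim_inr,
          (Finset.mem_insert.1 x.2).resolve_right hx]
    · ext x
      by_cases hx : x.1 ∈ F
      · simp [g, hx]
      · simp only [Function.comp_apply, show g x = .inr 0 from dif_neg hx, Sum.elim_inr,
          (Finset.mem_insert.1 x.2).resolve_right hx]
  have hQr : ∀ F, Q F → ∀ (k : Type) (g : k → F) (φ : L.Formula k),
      φ.Realize (fun i => (g i).1.1) ↔ φ.Realize (fun i => (g i).1.2) := by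
    intro F hF k g φ
    have := hF (φ.relabel g)
    rwa [FirstOrder.Language.Formula.realize_relabel,
      FirstOrder.Language.Formula.realize_relabel] at this
  obtain ⟨e, -, he⟩ := exists_equiv_of_back_and_forth Q
    (by
      intro F G hF hGF φ
      have := hF (φ.relabel (fun x : G => (⟨x.1, hGF x.2⟩ : F)))
      rwa [FirstOrder.Language.Formula.realize_relabel,
      FirstOrder.Language.Formula.realize_relabel] at this)
    (by
      intro F hF x hx y hy
      simpa using hQr F hF (Fin 2) ![⟨x, hx⟩, ⟨y, hy⟩]
        ((FirstOrder.Language.Term.var 0).equal (FirstOrder.Language.Term.var 1)))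
    (by
      intro F hF m
      obtain ⟨ι, χ, h1, h2, h3⟩ := (h (F ⊕ Fin 1)).exists_isolating hMN
      obtain ⟨i, hi⟩ := h1 (Sum.elim (fun x => x.1.1) fun _ => m)
      have := (hF ((χ i).iExs (Fin 1))).1 (FirstOrder.Language.Formula.realize_iExs.2 ⟨_, hi⟩)
      obtain ⟨n, hn⟩ := FirstOrder.Language.Formula.realize_iExs.1 this
      rw [show n = fun _ => n 0 from funext fun j => congrArg _ (Subsingleton.elim j 0)] at hn
      exact ⟨n 0, hinsert F m _ (h3 i _ _ hi hn)⟩)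
    (by
      intro F hF n
      obtain ⟨ι, χ, h1, h2, h3⟩ := (h (F ⊕ Fin 1)).exists_isolating hMN
      obtain ⟨i, hi⟩ := h2 (Sum.elim (fun x => x.1.2) fun _ => n)
      have := (hF ((χ i).iExs (Fin 1))).2 (FirstOrder.Language.Formula.realize_iExs.2 ⟨_, hi⟩)
      obtain ⟨m, hm⟩ := FirstOrder.Language.Formula.realize_iExs.1 this
      rw [show m = fun _ => m 0 from funext fun j => congrArg _ (Subsingleton.elim j 0)] at hm
      exact ⟨m 0, hinsert F _ n (h3 i _ _ hm hi)⟩)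
    ∅ (by
      intro φ
      let s : L.Sentence := φ.relabel (fun x => absurd x.2 (Finset.notMem_empty _))
      have h1 := hMN.realize_sentence s
      simp only [s, FirstOrder.Language.Sentence.Realize,
        FirstOrder.Language.Formula.realize_relabel] at h1
      convert h1 using 2
      · ext x; exact absurd x.2 (Finset.notMem_empty _)
      · ext x; exact absurd x.2 (Finset.notMem_empty _))
  have key : ∀ (n : ℕ) (x : Fin n → M) (φ : L.Formula (Fin n)),
      φ.Realize x ↔ φ.Realize (e ∘ x) := by
    intro n x φ
    exact hQr _ (he (Finset.univ.image x)) (Fin n)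
      (fun i => ⟨(x i, e (x i)), by simp⟩) φ
  refine ⟨{ e with map_fun' := ?_, map_rel' := ?_ }⟩
  · intro n f x
    have := key (n + 1) (Fin.snoc x (FirstOrder.Language.Structure.funMap f x))
      ((FirstOrder.Language.Term.func f fun i => FirstOrder.Language.Term.var i.castSucc).equal
        (FirstOrder.Language.Term.var (Fin.last n)))
    simp [FirstOrder.Language.Term.realize, Function.comp_def] at this
    exact this.symm
  · intro n r x
    have := key n x (r.formula fun i => FirstOrder.Language.Term.var i)
    simp [FirstOrder.Language.Formula.realize_rel, Function.comp_def] at this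
    exact this.symm

/-! ### Isolated tuples in countably categorical structures -/

namespace IsOmegaCategorical

variable {L : FirstOrder.Language.{0, v}} {M : Type u} [L.Structure M]

/-- A countable `ω`-categorical structure realizes each countable partial type that is finitely
satisfiable in it: an ultrapower realizes it, hence so does a countable elementary substructure of
the ultrapower, and the latter is isomorphic to `M`. -/
theorem nonempty_iInter (h : IsOmegaCategorical L M) [Countable L.Symbols] [Nonempty M]
    {α : Type w} [Finite α] (D : ℕ → Set (α → M)) (hD : Antitone D)
    (hdef : ∀ k, (∅ : Set M).Definable L (D k)) (hne : ∀ k, (D k).Nonempty) :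
    (⋂ k, D k).Nonempty := by
  choose φ hφ using fun k => empty_definable_iff.1 (hdef k)
  choose a ha using hne
  let U := ((Filter.hyperfilter ℕ : Ultrafilter ℕ) : Filter ℕ).Product (fun _ => M)
  let w : α → U := fun i => ((fun k => a k i : ℕ → M) : U)
  have hw : ∀ k, (φ k).Realize w := fun k => by
    refine (FirstOrder.Language.Ultraproduct.realize_formula_cast (φ k) _).2 ?_
    have : ∀ᶠ n in Filter.atTop, k ≤ n := Filter.eventually_ge_atTop k
    rw [← Nat.cofinite_eq_atTop] at this
    filter_upwards [Filter.hyperfilter_le_cofinite this] with n hn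
    have := hD hn (ha n)
    rwa [hφ k] at this
  have hMU : M ≅[L] U := by
    refine FirstOrder.Language.elementarilyEquivalent_iff.2 fun s => ?_
    rw [FirstOrder.Language.Ultraproduct.sentence_realize]
    simp
  obtain ⟨S, hwS, hS⟩ : ∃ S : L.ElementarySubstructure U, range w ⊆ S ∧ Countable S := by
    rcases finite_or_infinite U with hU | hU
    · exact ⟨⊤, fun x _ => trivial, inferInstance⟩
    · have hcL : L.card ≤ Cardinal.aleph0 := Cardinal.mk_le_aleph0_iff.2 ‹_›
      obtain ⟨S, h1, h2⟩ := FirstOrder.Language.exists_elementarySubstructure_card_eq L (range w)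
        Cardinal.aleph0.{0} le_rfl (by simp) (by simpa using hcL)
        (by simp)
      exact ⟨S, h1, Cardinal.mk_le_aleph0_iff.1 (by simpa using h2.le)⟩
  obtain ⟨e⟩ := h S hS (hMU.trans S.elementarilyEquivalent.symm)
  let w' : α → S := fun i => ⟨w i, hwS ⟨i, rfl⟩⟩
  refine ⟨e.symm ∘ w', mem_iInter.2 fun k => ?_⟩
  rw [hφ k]
  refine (FirstOrder.Language.StrongHomClass.realize_formula e.symm (φ k)).2 ?_
  exact (S.subtype.map_formula (φ k) w').1 (hw k)

end IsOmegaCategorical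

/-- The tuple `v` is isolated: there is a smallest `∅`-definable set that contains it. -/
def IsIsolatedTuple (L : FirstOrder.Language.{0, v}) {M : Type u} [L.Structure M] {α : Type w}
    (v : α → M) : Prop :=
  ∃ D : Set (α → M), (∅ : Set M).Definable L D ∧ v ∈ D ∧
    ∀ E : Set (α → M), (∅ : Set M).Definable L E → v ∈ E → D ⊆ E

theorem IsIsolatedTuple.comp {L : FirstOrder.Language.{0, v}} {M : Type u} [L.Structure M]
    {α β : Type*} [Finite α] [Finite β] {v : α → M} (h : IsIsolatedTuple L v) (g : β → α) :
    IsIsolatedTuple L (v ∘ g) := by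
  obtain ⟨D, hD, hv, hmin⟩ := h
  refine ⟨_, hD.image_comp g, ⟨v, hv, rfl⟩, fun E hE hvE => ?_⟩
  rintro _ ⟨x, hx, rfl⟩
  exact hmin _ (hE.preimage_comp g) hvE hx

namespace IsOmegaCategorical

variable {L : FirstOrder.Language.{0, v}} {M : Type u} [L.Structure M]

/-- Isolated tuples are dense. Otherwise a non-empty definable set could be shrunk step by step to
exclude the tuples of `M` one after the other. -/
theorem exists_isIsolatedTuple (h : IsOmegaCategorical L M) [Countable L.Symbols] [Countable M]
    [Nonempty M] {α : Type w} [Finite α] {D : Set (α → M)} (hD : (∅ : Set M).Definable L D)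
    (hne : D.Nonempty) : ∃ v ∈ D, IsIsolatedTuple L v := by
  by_contra! hcon
  let T := {E : Set (α → M) // (∅ : Set M).Definable L E ∧ E.Nonempty ∧ E ⊆ D}
  have hstep : ∀ (E : T) (v : α → M), ∃ E' : T, E'.1 ⊆ E.1 ∧ v ∉ E'.1 := by
    rintro ⟨E, hE, hEne, hED⟩ v
    by_cases hv : v ∈ E
    · have := hcon v (hED hv)
      simp only [IsIsolatedTuple, not_exists, not_and, not_forall] at this
      obtain ⟨F, hF, hvF, hEF⟩ := this E hE hv
      exact ⟨⟨E \ F, hE.sdiff hF, sdiff_nonempty.2 hEF, sdiff_subset.trans hED⟩, sdiff_subset,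
        fun h => h.2 hvF⟩
    · exact ⟨⟨E, hE, hEne, hED⟩, subset_rfl, hv⟩
  choose next hnext1 hnext2 using hstep
  obtain ⟨f, hf⟩ := exists_surjective_nat (α → M)
  let E : ℕ → T := fun n => Nat.rec ⟨D, hD, hne, subset_rfl⟩ (fun k E => next E (f k)) n
  obtain ⟨v, hv⟩ := h.nonempty_iInter (fun k => (E k).1)
    (antitone_nat_of_succ_le fun k => hnext1 _ _) (fun k => (E k).2.1) (fun k => (E k).2.2.1)
  obtain ⟨k, rfl⟩ := hf v
  exact hnext2 (E k) (f k) (mem_iInter.1 hv (k + 1))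

/-- A definable set with parameters in an isolated tuple contains a point that extends this tuple
to an isolated one. -/
theorem exists_isIsolatedTuple_extension (h : IsOmegaCategorical L M) [Countable L.Symbols]
    [Countable M] [Nonempty M] {α : Type w} [Finite α] {v : α → M} (hv : IsIsolatedTuple L v)
    {E : Set (α ⊕ Fin 1 → M)} (hE : (∅ : Set M).Definable L E)
    (hne : ∃ m, Sum.elim v (fun _ => m) ∈ E) :
    ∃ m, Sum.elim v (fun _ => m) ∈ E ∧ IsIsolatedTuple L (Sum.elim v fun _ : Fin 1 => m) := by
  obtain ⟨D, hD, hvD, hmin⟩ := hv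
  obtain ⟨m, hm⟩ := hne
  obtain ⟨x, ⟨hxD, hxE⟩, C, hC, hxC, hCmin⟩ :=
    h.exists_isIsolatedTuple ((hD.preimage_comp Sum.inl).inter hE) ⟨_, hvD, hm⟩
  -- `v` has the same type as the restriction of `x`, hence lies in the projection of `C`
  have hvC : v ∈ (fun y : α ⊕ Fin 1 → M => y ∘ Sum.inl) '' C := by
    by_contra hcon
    have := hmin _ (hC.image_comp (Sum.inl : α → α ⊕ Fin 1)).compl hcon hxD
    exact this ⟨x, hxC, rfl⟩
  obtain ⟨y, hyC, rfl⟩ := hvC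
  have hy : y = Sum.elim (y ∘ Sum.inl) fun _ => y (.inr 0) := by
    ext (i | i)
    · rfl
    · rw [Subsingleton.elim i 0]; rfl
  refine ⟨y (.inr 0), ?_⟩
  rw [← hy]
  refine ⟨hCmin _ hE hxE hyC, C, hC, hyC, fun F hF hyF => hCmin F hF ?_⟩
  by_contra hcon
  exact hCmin _ hF.compl hcon hyC hyF

/-- A countable `ω`-categorical structure is atomic, because it has a countable elementary
substructure that consists of components of isolated tuples. -/
theorem isIsolatedTuple_single (h : IsOmegaCategorical L M) [Countable L.Symbols] [Countable M]
    [Nonempty M] (m : M) : IsIsolatedTuple L (fun _ : Fin 1 => m) := by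
  classical
  let S := {F : Finset M // IsIsolatedTuple L (fun x : F => x.1)}
  have hinsert : ∀ (F : Finset M) (b : M),
      IsIsolatedTuple L (Sum.elim (fun x : F => x.1) fun _ : Fin 1 => b) →
        IsIsolatedTuple L (fun x : (insert b F : Finset M) => x.1) := by
    intro F b hF
    let g : {x // x ∈ insert b F} → F ⊕ Fin 1 := fun x =>
      if hx : x.1 ∈ F then .inl ⟨x.1, hx⟩ else .inr 0
    convert hF.comp g using 1
    ext x
    by_cases hx : x.1 ∈ F
    · simp [g, hx]
    · simp only [Function.comp_apply, show g x = .inr 0 from dif_neg hx, Sum.elim_inr,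
        (Finset.mem_insert.1 x.2).resolve_right hx]
  have hempty : IsIsolatedTuple L (fun x : (∅ : Finset M) => x.1) :=
    ⟨univ, definable_univ, trivial, fun E _ hE x _ => by
      rwa [Subsingleton.elim x fun x => x.1]⟩
  let I := Σ A₀ : Finset M, L.Formula (A₀ ⊕ Fin 1)
  obtain ⟨_⟩ := nonempty_encodable I
  -- A generic union of finite isolated sets meets each non-empty set that is defined with finitely
  -- many parameters `A₀` in it. The first alternative, that no isolated set above `F` contains
  -- `A₀`, is preserved upwards and excluded when `A₀` lies in the generic union.
  let 𝒟 : I → Order.Cofinal S := fun i =>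
    { carrier := {F | (∀ F' : S, F ≤ F' → ¬ i.1 ⊆ F'.1) ∨
        ((∃ b, i.2.Realize (Sum.elim (fun x => x.1) fun _ => b)) →
          ∃ b ∈ F.1, i.2.Realize (Sum.elim (fun x => x.1) fun _ => b))}
      isCofinal := by
        intro F
        by_cases hF : ∀ F' : S, F ≤ F' → ¬ i.1 ⊆ F'.1
        · exact ⟨F, Or.inl hF, le_rfl⟩
        push Not at hF
        obtain ⟨F', hFF', hi⟩ := hF
        by_cases hb : ∃ b, i.2.Realize (Sum.elim (fun x => x.1) fun _ => b)
        · let E : Set (F'.1 ⊕ Fin 1 → M) :=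
            {y | (i.2.relabel (Sum.map (fun x => (⟨x.1, hi x.2⟩ : F'.1)) id)).Realize y}
          have hE : ∀ b, Sum.elim (fun x : F'.1 => x.1) (fun _ => b) ∈ E ↔
              i.2.Realize (Sum.elim (fun x => x.1) fun _ => b) := by
            intro b
            simp only [E, mem_ofPred_eq, FirstOrder.Language.Formula.realize_relabel,
              Sum.elim_comp_map]
            rfl
          obtain ⟨b, hbE, hb'⟩ := h.exists_isIsolatedTuple_extension F'.2
            (E := E) (empty_definable_iff.2 ⟨_, rfl⟩) (hb.imp fun b => (hE b).2)
          exact ⟨⟨insert b F'.1, hinsert _ _ hb'⟩,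
            Or.inr fun _ => ⟨b, Finset.mem_insert_self _ _, (hE b).1 hbE⟩,
            hFF'.trans (Finset.subset_insert _ _)⟩
        · exact ⟨F', Or.inr fun hb' => absurd hb' hb, hFF'⟩ }
  let G := Order.idealOfCofinals (⟨∅, hempty⟩ : S) 𝒟
  let A : Set M := {x | ∃ F ∈ G, x ∈ F.1}
  have hdir : ∀ A₀ : Finset M, (A₀ : Set M) ⊆ A → ∃ F ∈ G, A₀ ⊆ F.1 := by
    intro A₀
    induction A₀ using Finset.induction_on with
    | empty => exact fun _ => ⟨_, Order.mem_idealOfCofinals _ _, Finset.empty_subset _⟩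
    | insert a A₀ _ ih =>
      intro hA
      rw [Finset.coe_insert, insert_subset_iff] at hA
      obtain ⟨F, hF, hGF⟩ := ih hA.2
      obtain ⟨F', hF', haF'⟩ := hA.1
      obtain ⟨K, hK, h1, h2⟩ := G.directed F hF F' hF'
      exact ⟨K, hK, Finset.insert_subset (h2 haF') (hGF.trans h1)⟩
  have hA : L.MeetsDefinable A := by
    rintro D ⟨b, hb⟩ hD
    obtain ⟨A₀, hA₀, hD⟩ := definable_iff_finitely_definable.1 hD
    obtain ⟨φ, hφ⟩ := definable_iff_exists_formula_sum.1 hD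
    have hφ' : ∀ b, b ∈ D ↔ φ.Realize (Sum.elim (fun x => x.1) fun _ => b) := fun b => by
      have := Set.ext_iff.1 hφ fun _ => b
      simpa using this
    obtain ⟨F, hFD, hFG⟩ :=
      Order.cofinal_meets_idealOfCofinals (⟨∅, hempty⟩ : S) 𝒟 ⟨A₀, φ⟩
    obtain ⟨F', hF', hA₀F'⟩ := hdir A₀ hA₀
    obtain ⟨K, hK, h1, h2⟩ := G.directed F hFG F' hF'
    rcases hFD with hFD | hFD
    · exact absurd (hA₀F'.trans h2) (hFD K h1)
    · obtain ⟨b, hbF, hb⟩ := hFD ⟨b, (hφ' b).1 hb⟩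
      exact ⟨b, (hφ' b).2 hb, F, hFG, hbF⟩
  let N := hA.toElementarySubstructure
  have hN : ∀ x : N, x.1 ∈ A := fun x => by
    have := x.2
    rwa [← hA.closure_eq_self]
  obtain ⟨e⟩ := h N inferInstance N.elementarilyEquivalent.symm
  have hj : ∀ (φ : L.Formula (Fin 1)) (x : M),
      φ.Realize (fun _ => (e x : M)) ↔ φ.Realize fun _ => x := by
    intro φ x
    refine (N.subtype.map_formula φ fun _ => e x).trans ?_
    exact FirstOrder.Language.StrongHomClass.realize_formula e φ
  obtain ⟨F, -, hF⟩ := hN (e m)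
  obtain ⟨D, hD, hmD, hmin⟩ := F.2.comp fun _ : Fin 1 => ⟨_, hF⟩
  obtain ⟨φ, rfl⟩ := empty_definable_iff.1 hD
  refine ⟨_, hD, (hj φ m).1 hmD, fun E hE hmE => hmin E hE ?_⟩
  obtain ⟨ψ, rfl⟩ := empty_definable_iff.1 hE
  exact (hj ψ m).2 hmE

/-- The other direction of the Ryll-Nardzewski theorem, for types in one variable. -/
theorem hasFinitelyManyTypes (h : IsOmegaCategorical L M) [Countable L.Symbols] [Countable M]
    [Nonempty M] : HasFinitelyManyTypes L M (Fin 1) := by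
  have hiso : ∀ v : Fin 1 → M, IsIsolatedTuple L v := fun v => by
    convert h.isIsolatedTuple_single (v 0) using 1
    ext j
    rw [Subsingleton.elim j 0]
  choose D hD hmem hmin using hiso
  obtain ⟨f, hf⟩ := exists_surjective_nat (Fin 1 → M)
  -- finitely many of the isolating sets `D v` cover everything
  obtain ⟨k, hk⟩ : ∃ k, ∀ w, ∃ i < k, w ∈ D (f i) := by
    by_contra! hcon
    have hdef : ∀ k, (∅ : Set M).Definable L (⋂ i : Fin k, (D (f i))ᶜ) := fun k =>
      definable_iInter_of_finite fun i => (hD _).compl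
    obtain ⟨w, hw⟩ := h.nonempty_iInter (fun k => ⋂ i : Fin k, (D (f i))ᶜ)
      (fun k l hkl w hw => mem_iInter.2 fun i => mem_iInter.1 hw (i.castLE hkl)) hdef
      (fun k => (hcon k).imp fun w hw => mem_iInter.2 fun i => hw i i.2)
    obtain ⟨n, rfl⟩ := hf w
    exact mem_iInter.1 (mem_iInter.1 hw (n + 1)) (Fin.last n) (hmem _)
  refine ⟨f '' Iio k, (finite_Iio k).image f, fun w => ?_⟩
  obtain ⟨i, hi, hw⟩ := hk w
  refine ⟨f i, mem_image_of_mem f hi, fun φ => ⟨fun hφ => ?_, fun hφ => ?_⟩⟩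
  · exact hmin (f i) (Set.ofPred φ.Realize) (empty_definable_iff.2 ⟨φ, rfl⟩) hφ hw
  · by_contra hcon
    have := hmin (f i) (Set.ofPred φ.Realize)ᶜ (empty_definable_iff.2 ⟨φ, rfl⟩).compl hcon hw
    exact this hφ

end IsOmegaCategorical

/-! ### The Stone space of a countable Boolean ring -/

namespace StoneSpace

variable {R : Type u} [NonUnitalRing R]

theorem zmod_two_eq_zero_iff (z : ZMod 2) : z = 0 ↔ ¬ z = 1 := by
  revert z; decide

theorem mem_basicOpen {x : StoneSpace R} {a : R} : x ∈ basicOpen a ↔ x.1 a = 1 := Iff.rfl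

theorem basicOpen_zero : basicOpen (0 : R) = ∅ := by
  ext x
  simp [mem_basicOpen]

theorem mem_basicOpen_mul {x : StoneSpace R} {a b : R} :
    x ∈ basicOpen (a * b) ↔ x ∈ basicOpen a ∧ x ∈ basicOpen b := by
  simp only [mem_basicOpen, map_mul]
  generalize x.1 a = s
  generalize x.1 b = t
  revert s t; decide

theorem mem_basicOpen_add {x : StoneSpace R} {a b : R} :
    x ∈ basicOpen (a + b) ↔ ¬ (x ∈ basicOpen a ↔ x ∈ basicOpen b) := by
  simp only [mem_basicOpen, map_add]
  generalize x.1 a = s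
  generalize x.1 b = t
  revert s t; decide

theorem basicOpen_mul (a b : R) : basicOpen (a * b) = basicOpen a ∩ basicOpen b :=
  Set.ext fun _ => mem_basicOpen_mul

theorem basicOpen_add_mul (a b : R) : basicOpen (a + a * b) = basicOpen a \ basicOpen b := by
  ext x
  rw [mem_basicOpen_add, mem_basicOpen_mul, mem_sdiff]
  tauto

theorem basicOpen_add_add_mul (a b : R) :
    basicOpen (a + b + a * b) = basicOpen a ∪ basicOpen b := by
  ext x
  rw [mem_basicOpen_add, mem_basicOpen_add, mem_basicOpen_mul, mem_union]
  tauto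

theorem exists_mem_basicOpen (x : StoneSpace R) : ∃ a, x ∈ basicOpen a := by
  by_contra! h
  refine x.2 (NonUnitalRingHom.ext fun a => ?_)
  exact (zmod_two_eq_zero_iff _).2 (h a)

theorem isTopologicalBasis_basicOpen :
    TopologicalSpace.IsTopologicalBasis (range (basicOpen (R := R))) where
  exists_subset_inter := by
    rintro _ ⟨a, rfl⟩ _ ⟨b, rfl⟩ x hx
    exact ⟨_, ⟨a * b, rfl⟩, mem_basicOpen_mul.2 hx, (basicOpen_mul a b).subset⟩
  sUnion_eq := eq_univ_of_forall fun x =>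
    let ⟨a, ha⟩ := exists_mem_basicOpen x
    ⟨_, ⟨a, rfl⟩, ha⟩
  eq_generateFrom := rfl

theorem isOpen_basicOpen (a : R) : IsOpen (basicOpen a) :=
  isTopologicalBasis_basicOpen.isOpen ⟨a, rfl⟩

theorem isClosed_basicOpen (a : R) : IsClosed (basicOpen a) := by
  refine ⟨isOpen_iff_forall_mem_open.2 fun x hx => ?_⟩
  obtain ⟨b, hb⟩ := exists_mem_basicOpen x
  refine ⟨basicOpen (b + b * a), ?_, isOpen_basicOpen _, ?_⟩
  · rw [basicOpen_add_mul]
    exact fun y hy => hy.2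
  · rw [basicOpen_add_mul]
    exact ⟨hb, hx⟩

instance : T2Space (StoneSpace R) := by
  refine ⟨fun x y hxy => ?_⟩
  obtain ⟨a, ha⟩ : ∃ a, x.1 a ≠ y.1 a := by
    by_contra! h
    exact hxy (Subtype.ext (NonUnitalRingHom.ext h))
  have key : ∀ s t : ZMod 2, s ≠ t → (s = 1 ∧ ¬ t = 1) ∨ (t = 1 ∧ ¬ s = 1) := by decide
  rcases key _ _ ha with ⟨h1, h2⟩ | ⟨h1, h2⟩
  · exact ⟨_, _, isOpen_basicOpen a, (isClosed_basicOpen a).isOpen_compl, h1, h2,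
      disjoint_compl_right⟩
  · exact ⟨_, _, (isClosed_basicOpen a).isOpen_compl, isOpen_basicOpen a, h2, h1,
      disjoint_compl_left⟩

/-- `basicOpen a` is a continuous image of a closed subspace of the product space `R → ZMod 2`. -/
theorem isCompact_basicOpen (a : R) : IsCompact (basicOpen a) := by
  let K : Set (R → ZMod 2) :=
    {f | (∀ b c, f (b + c) = f b + f c) ∧ (∀ b c, f (b * c) = f b * f c) ∧ f a = 1}
  have hK : IsClosed K := by
    have h1 : ∀ b c : R, IsClosed {f : R → ZMod 2 | f (b + c) = f b + f c} := fun b c =>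
      isClosed_eq (by fun_prop) (by fun_prop)
    have h2 : ∀ b c : R, IsClosed {f : R → ZMod 2 | f (b * c) = f b * f c} := fun b c =>
      isClosed_eq (by fun_prop) (by fun_prop)
    have h3 : IsClosed {f : R → ZMod 2 | f a = 1} := isClosed_eq (by fun_prop) (by fun_prop)
    convert (isClosed_iInter fun b => isClosed_iInter (h1 b)).inter
      ((isClosed_iInter fun b => isClosed_iInter (h2 b)).inter h3) using 1
    ext f
    simp [K]
  have : CompactSpace K := isCompact_iff_compactSpace.1 hK.isCompact
  let toHom : K → R →ₙ+* ZMod 2 := fun f =>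
    { toFun := f.1
      map_mul' := f.2.2.1
      map_add' := f.2.1
      map_zero' := by simpa using f.2.1 0 0 }
  let g : K → StoneSpace R := fun f => ⟨toHom f, fun h => by
    have h1 : toHom f a = 1 := f.2.2.2
    rw [h] at h1
    exact zero_ne_one h1⟩
  have hg : Continuous g := by
    refine continuous_generateFrom_iff.2 ?_
    rintro _ ⟨b, rfl⟩
    have hb : Continuous fun f : K => f.1 b := (continuous_apply b).comp continuous_subtype_val
    exact (isOpen_discrete ({1} : Set (ZMod 2))).preimage hb
  convert isCompact_range hg
  ext x
  refine ⟨fun hx => ⟨⟨x.1, map_add x.1, map_mul x.1, hx⟩, rfl⟩, ?_⟩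
  rintro ⟨f, rfl⟩
  exact f.2.2.2

/-- A compact set and an open set around it can be separated by a compact open set. -/
theorem exists_basicOpen_between {C O : Set (StoneSpace R)} (hC : IsCompact C) (hO : IsOpen O)
    (hCO : C ⊆ O) : ∃ a, C ⊆ basicOpen a ∧ basicOpen a ⊆ O := by
  refine hC.induction_on (p := fun s => ∃ a, s ⊆ basicOpen a ∧ basicOpen a ⊆ O) ?_ ?_ ?_ ?_
  · exact ⟨0, empty_subset _, by simp [basicOpen_zero]⟩
  · rintro s t hst ⟨a, h1, h2⟩
    exact ⟨a, hst.trans h1, h2⟩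
  · rintro s t ⟨a, h1, h2⟩ ⟨b, h3, h4⟩
    refine ⟨a + b + a * b, ?_⟩
    rw [basicOpen_add_add_mul]
    exact ⟨union_subset_union h1 h3, union_subset h2 h4⟩
  · intro x hx
    obtain ⟨_, ⟨a, rfl⟩, hxa, haO⟩ :=
      isTopologicalBasis_basicOpen.exists_subset_of_mem_open (hCO hx) hO
    exact ⟨basicOpen a, mem_nhdsWithin_of_mem_nhds ((isOpen_basicOpen a).mem_nhds hxa), a,
      subset_rfl, haO⟩

theorem exists_eq_basicOpen {C : Set (StoneSpace R)} (hC : IsCompact C) (hO : IsOpen C) :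
    ∃ a, basicOpen a = C :=
  let ⟨a, h1, h2⟩ := exists_basicOpen_between hC hO subset_rfl
  ⟨a, h2.antisymm h1⟩

theorem add_self_eq_zero_of_boolean (hR : ∀ a : R, a * a = a) (a : R) : a + a = 0 := by
  have h := hR (a + a)
  rw [mul_add, add_mul, hR] at h
  simpa using h

theorem mul_comm_of_boolean (hR : ∀ a : R, a * a = a) (a b : R) : a * b = b * a := by
  have h := hR (a + b)
  rw [mul_add, add_mul, add_mul, hR, hR] at h
  have h2 : a * b + b * a = 0 := by
    rw [← sub_self (a + b)]
    nth_rewrite 1 [← h]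
    abel
  rw [← add_self_eq_zero_of_boolean hR (b * a)] at h2
  exact add_right_cancel h2

/-- The prime ideal theorem for countable Boolean rings. Going through the elements of `R`, one
shrinks `a` to a decreasing sequence of non-zero elements that decides each of them; the
homomorphism sends `b` to `1` if and only if the sequence gets below `b`. -/
theorem basicOpen_nonempty [Countable R] (hR : ∀ a : R, a * a = a) {a : R} (ha : a ≠ 0) :
    (basicOpen a).Nonempty := by
  classical
  obtain ⟨r, hr⟩ := exists_surjective_nat R
  have hcomm := mul_comm_of_boolean hR
  let s : ℕ → R := fun n => Nat.rec a (fun k b => if b * r k = 0 then b else b * r k) n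
  have hs : ∀ k, s (k + 1) = if s k * r k = 0 then s k else s k * r k := fun k => rfl
  have hs0 : ∀ k, s k ≠ 0 := by
    intro k
    induction k with
    | zero => exact ha
    | succ k ih =>
      rw [hs]
      split_ifs with h
      exacts [ih, h]
  have hle : ∀ k l, k ≤ l → s l * s k = s l := by
    intro k l hkl
    induction l, hkl using Nat.le_induction with
    | base => exact hR _
    | succ l _ ih =>
      rw [hs]
      split_ifs with h
      · exact ih
      · rw [mul_assoc, hcomm (r l), ← mul_assoc, ih]
  have hdec : ∀ b, ∃ z : ZMod 2, ∀ᶠ l in Filter.atTop, s l * b = if z = 1 then s l else 0 := by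
    intro b
    obtain ⟨k, rfl⟩ := hr b
    have hk : s (k + 1) * r k = 0 ∨ s (k + 1) * r k = s (k + 1) := by
      rw [hs]
      split_ifs with h
      · exact Or.inl h
      · right
        rw [mul_assoc, hR]
    rcases hk with hk | hk
    · refine ⟨0, Filter.eventually_atTop.2 ⟨k + 1, fun l hl => ?_⟩⟩
      rw [← hle _ _ hl, mul_assoc, hk, mul_zero]
      simp
    · refine ⟨1, Filter.eventually_atTop.2 ⟨k + 1, fun l hl => ?_⟩⟩
      rw [← hle _ _ hl, mul_assoc, hk]
      simp
  choose f hf using hdec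
  have huniq : ∀ b (z : ZMod 2), (∀ᶠ l in Filter.atTop, s l * b = if z = 1 then s l else 0) →
      f b = z := by
    intro b z hz
    obtain ⟨l, h1, h2⟩ := ((hf b).and hz).exists
    rw [h1] at h2
    have key : ∀ z w : ZMod 2, ((z = 1) ↔ (w = 1)) → z = w := by decide
    refine key _ _ ?_
    have := hs0 l
    split_ifs at h2 <;> simp_all
  have h11 : ¬ (1 + 1 : ZMod 2) = 1 := by decide
  have h0 : ∀ z : ZMod 2, ¬ z = 1 → z = 0 := by decide
  let φ : R →ₙ+* ZMod 2 :=
    { toFun := f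
      map_zero' := huniq _ _ (by simp)
      map_add' := fun b c => huniq _ _ (by
        filter_upwards [hf b, hf c] with l hb hc
        rw [mul_add, hb, hc]
        by_cases h1 : f b = 1 <;> by_cases h2 : f c = 1
        · simp [h1, h2, h11, add_self_eq_zero_of_boolean hR]
        · simp [h1, h0 _ h2]
        · simp [h2, h0 _ h1]
        · simp [h0 _ h1, h0 _ h2])
      map_mul' := fun b c => huniq _ _ (by
        filter_upwards [hf b, hf c] with l hb hc
        rw [← mul_assoc, hb]
        by_cases h1 : f b = 1
        · simp [h1, hc]
        · simp [h0 _ h1]) }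
  have hφ : φ a = 1 := huniq _ _ (Filter.Eventually.of_forall fun l => by
    simpa using! hle 0 l (Nat.zero_le l))
  exact ⟨⟨φ, fun h => by rw [h] at hφ; exact zero_ne_one hφ⟩, hφ⟩

theorem basicOpen_injective [Countable R] (hR : ∀ a : R, a * a = a) :
    Function.Injective (basicOpen (R := R)) := by
  intro a b hab
  by_contra hne
  have hne' : a + b ≠ 0 := fun h => hne <| by
    rw [← add_self_eq_zero_of_boolean hR b] at h
    exact add_right_cancel h
  obtain ⟨x, hx⟩ := basicOpen_nonempty hR hne'
  rw [mem_basicOpen_add, hab] at hx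
  exact hx Iff.rfl

theorem mem_idealOf_closure {C : Set (StoneSpace R)} {a : R} :
    a ∈ idealOf (closure C) ↔ ¬ (basicOpen a ∩ C).Nonempty := by
  rw [← disjoint_iff_inter_eq_empty.trans not_nonempty_iff_eq_empty.symm]
  exact ⟨fun h => h.mono_right subset_closure, fun h => h.closure_right (isOpen_basicOpen a)⟩

end StoneSpace

/-! ### Complete partitions -/

namespace IsCompletePartition

variable {P : Type v} {lt : P → P → Prop} {X : Type u} [TopologicalSpace X] {A : P → Set X}

theorem eq_of_mem (hA : IsCompletePartition lt A) {p q : P} {x : X} (hp : x ∈ A p)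
    (hq : x ∈ A q) : p = q := by
  by_contra h
  exact disjoint_left.1 (hA.disjoint p q h) hp hq

theorem exists_mem (hA : IsCompletePartition lt A) (x : X) : ∃ p, x ∈ A p :=
  mem_iUnion.1 (hA.cover ▸ mem_univ x)

theorem injective (hA : IsCompletePartition lt A) : Function.Injective A := fun p q h => by
  obtain ⟨x, hx⟩ := hA.nonempty p
  exact hA.eq_of_mem hx (h ▸ hx)

theorem mem_closure_iff (hA : IsCompletePartition lt A) {p q : P} {x : X} (hx : x ∈ A q) :
    x ∈ closure (A p) ↔ q = p ∨ lt q p := by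
  rw [closure_eq_self_union_derivedSet, hA.derived, mem_union, mem_iUnion₂]
  refine or_congr ⟨fun h => hA.eq_of_mem hx h, fun h => h ▸ hx⟩ ⟨?_, fun h => ⟨q, h, hx⟩⟩
  rintro ⟨r, hr, hxr⟩
  rwa [hA.eq_of_mem hx hxr]

theorem preperfect_of_lt_self (hA : IsCompletePartition lt A) {p : P} (h : lt p p) :
    Preperfect (A p) := by
  rw [preperfect_iff_subset_derivedSet, hA.derived]
  exact fun x hx => mem_iUnion₂.2 ⟨p, h, hx⟩

theorem notMem_derivedSet (hA : IsCompletePartition lt A) {p : P} (h : ¬ lt p p) {x : X}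
    (hx : x ∈ A p) : x ∉ derivedSet (A p) := by
  rw [hA.derived, mem_iUnion₂]
  rintro ⟨q, hq, hxq⟩
  obtain rfl := hA.eq_of_mem hx hxq
  exact h hq

/-- The parts that meet an open set form an upper set. -/
theorem inter_nonempty_of_lt (hA : IsCompletePartition lt A) {U : Set X} (hU : IsOpen U) {p q : P}
    (hpq : lt p q) (hp : (U ∩ A p).Nonempty) : (U ∩ A q).Nonempty := by
  obtain ⟨x, hxU, hx⟩ := hp
  exact _root_.mem_closure_iff.1 ((hA.mem_closure_iff hx).2 (Or.inr hpq)) U hU hxU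

/-- In a finite partition, a union of parts over an upper set is open. -/
theorem isOpen_biUnion [Finite P] (hA : IsCompletePartition lt A) {T : Set P}
    (hT : ∀ p q, lt p q → p ∈ T → q ∈ T) : IsOpen (⋃ p ∈ T, A p) := by
  have : (⋃ p ∈ T, A p) = (⋃ p ∈ Tᶜ, closure (A p))ᶜ := by
    ext x
    obtain ⟨q, hq⟩ := hA.exists_mem x
    simp only [mem_iUnion, mem_compl_iff, hA.mem_closure_iff hq, not_exists]
    constructor
    · rintro ⟨p, hp, hx⟩ r hr hqr
      obtain rfl := hA.eq_of_mem hq hx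
      rcases hqr with rfl | hqr
      · exact hr hp
      · exact hr (hT _ _ hqr hp)
    · intro h
      exact ⟨q, by_contra fun hqT => h q hqT (Or.inl rfl), hq⟩
  rw [this]
  exact (isOpen_compl_iff.2 ((toFinite _).isClosed_biUnion fun p _ => isClosed_closure))

end IsCompletePartition

theorem Preperfect.encard_inter_eq_top {X : Type u} [TopologicalSpace X] [T1Space X] {C U : Set X}
    (hC : Preperfect C) (hU : IsOpen U) (h : (U ∩ C).Nonempty) : (U ∩ C).encard = ⊤ := by
  obtain ⟨x, hxU, hxC⟩ := h
  exact encard_eq_top_iff.2 (Set.Infinite.of_accPt ((hC x hxC).nhds_inter (hU.mem_nhds hxU)))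

theorem Preperfect.encard_inter_congr {X : Type u} [TopologicalSpace X] [T1Space X] {C U V : Set X}
    (hC : Preperfect C) (hU : IsOpen U) (hV : IsOpen V)
    (h : (U ∩ C).Nonempty ↔ (V ∩ C).Nonempty) : (U ∩ C).encard = (V ∩ C).encard := by
  by_cases hUC : (U ∩ C).Nonempty
  · rw [hC.encard_inter_eq_top hU hUC, hC.encard_inter_eq_top hV (h.1 hUC)]
  · rw [not_nonempty_iff_eq_empty.1 hUC, not_nonempty_iff_eq_empty.1 (h.not.1 hUC)]

/-- A set `S` that is as large as the union of disjoint sets `C₁` and `C₂` contains disjoint finite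
sets `W₁` and `W₂` that are non-empty when these are. If `S` is finite, they can be taken to split
`S` as `C₁` and `C₂` do. -/
theorem exists_disjoint_finite_subsets {X : Type u} {S C₁ C₂ : Set X}
    (hS : S.encard = C₁.encard + C₂.encard) :
    ∃ W₁ W₂ : Set X, W₁ ⊆ S ∧ W₂ ⊆ S ∧ Disjoint W₁ W₂ ∧ W₁.Finite ∧ W₂.Finite ∧
      (W₁.Nonempty ↔ C₁.Nonempty) ∧ (W₂.Nonempty ↔ C₂.Nonempty) ∧
      (S.Finite → W₁ ∪ W₂ = S ∧ W₁.encard = C₁.encard ∧ W₂.encard = C₂.encard) := by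
  classical
  by_cases hfin : S.Finite
  · obtain ⟨W₁, hW, hc⟩ := exists_subset_encard_eq (hS ▸ le_self_add : C₁.encard ≤ S.encard)
    have hW₁ := hfin.subset hW
    have hc2 : (S \ W₁).encard = C₂.encard := by
      have h := encard_sdiff_add_encard_of_subset hW
      rw [hS, ← hc, add_comm] at h
      exact (WithTop.add_left_inj hW₁.encard_lt_top.ne).1 h
    refine ⟨W₁, S \ W₁, hW, sdiff_subset, disjoint_sdiff_right, hW₁, hfin.subset sdiff_subset,
      ?_, ?_, fun _ => ⟨union_sdiff_cancel hW, hc, hc2⟩⟩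
    · rw [← encard_ne_zero, ← encard_ne_zero, hc]
    · rw [← encard_ne_zero, ← encard_ne_zero, hc2]
  · obtain ⟨x, hx, y, hy, hxy⟩ := (show S.Infinite from hfin).nontrivial
    refine ⟨if C₁.Nonempty then {x} else ∅, if C₂.Nonempty then {y} else ∅, ?_, ?_, ?_, ?_, ?_,
      ?_, ?_, fun h => absurd h hfin⟩ <;> split_ifs <;> simp_all

namespace StoneSpace

variable {R : Type u} [NonUnitalRing R] {P : Type v} {lt : P → P → Prop}
  {A : P → Set (StoneSpace R)}

/-- The splitting step of the back-and-forth argument. If the open sets `U` and `V` meet all parts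
of a finite-crowded partition in equally many points, then a compact open subset `c` of `U` has a
counterpart `d` in `V`, such that both `c`, `d` and their complements agree in this way. The
hypothesis on the compact open subset `k` of `V` says that the part of `V` outside `k`, which will
stay in the complement of `d`, causes no harm.

One picks finitely many witness points `W₁` for `d` and `W₂` for its complement. All other points
of `V` can be distributed freely among `d` and its complement, if only each of the two gets a
subset of the union of the parts it has to meet, which is an open set. -/
theorem exists_split [Finite P] (hA : IsCompletePartition lt A)
    (hfc : ∀ p, (A p).Finite ∨ Preperfect (A p)) {U V : Set (StoneSpace R)} (hU : IsOpen U)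
    (hV : IsOpen V) (hUV : ∀ p, (U ∩ A p).encard = (V ∩ A p).encard) {c k : R}
    (hc : basicOpen c ⊆ U) (hk : basicOpen k ⊆ V)
    (hres : ∀ p, ((V \ basicOpen k) ∩ A p).Nonempty → ((U \ basicOpen c) ∩ A p).Nonempty) :
    ∃ d, basicOpen d ⊆ V ∧ ∀ p,
      (basicOpen c ∩ A p).encard = (basicOpen d ∩ A p).encard ∧
      ((U \ basicOpen c) ∩ A p).encard = ((V \ basicOpen d) ∩ A p).encard := by
  have hsum : ∀ p, (V ∩ A p).encard =
      (basicOpen c ∩ A p).encard + ((U \ basicOpen c) ∩ A p).encard := fun p => by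
    rw [← hUV, ← encard_union_eq, ← union_inter_distrib_right, union_sdiff_cancel hc]
    exact disjoint_sdiff_right.mono inter_subset_left inter_subset_left
  choose W₁ W₂ hW₁ hW₂ hdisj hfin₁ hfin₂ hne₁ hne₂ hfin using
    fun p => exists_disjoint_finite_subsets (hsum p)
  have hdisj' : ∀ p q, Disjoint (W₁ p) (W₂ q) := fun p q => by
    by_cases hpq : p = q
    · exact hpq ▸ hdisj p
    · exact (hA.disjoint p q hpq).mono (fun x hx => (hW₁ p hx).2) (fun x hx => (hW₂ q hx).2)
  have hUc : IsOpen (U \ basicOpen c) := hU.sdiff (isClosed_basicOpen c)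
  -- the witness points are moved into `k`
  have hWfin : (⋃ p, (W₁ p ∪ W₂ p)).Finite := finite_iUnion fun p => (hfin₁ p).union (hfin₂ p)
  obtain ⟨e, hWe, heV⟩ := exists_basicOpen_between hWfin.isCompact hV
    (iUnion_subset fun p => union_subset (fun x hx => (hW₁ p hx).1) fun x hx => (hW₂ p hx).1)
  obtain ⟨K, hK⟩ : ∃ K : R, basicOpen K = basicOpen k ∪ basicOpen e :=
    ⟨_, basicOpen_add_add_mul k e⟩
  have hKV : basicOpen K ⊆ V := hK ▸ union_subset hk heV
  have hWK₁ : ∀ p, W₁ p ⊆ basicOpen K := fun p x hx =>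
    hK ▸ Or.inr (hWe (mem_iUnion.2 ⟨p, Or.inl hx⟩))
  have hWK₂ : ∀ p, W₂ p ⊆ basicOpen K := fun p x hx =>
    hK ▸ Or.inr (hWe (mem_iUnion.2 ⟨p, Or.inr hx⟩))
  let T₁ : Set P := {p | (basicOpen c ∩ A p).Nonempty}
  let T₂ : Set P := {p | ((U \ basicOpen c) ∩ A p).Nonempty}
  let O₁ := (⋃ p ∈ T₁, A p) \ ⋃ p, W₂ p
  let O₂ := (⋃ p ∈ T₂, A p) \ ⋃ p, W₁ p
  have hO₁ : IsOpen O₁ :=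
    (hA.isOpen_biUnion fun p q hpq hp =>
      hA.inter_nonempty_of_lt (isOpen_basicOpen c) hpq hp).sdiff
    (finite_iUnion hfin₂).isClosed
  have hO₂ : IsOpen O₂ :=
    (hA.isOpen_biUnion fun p q hpq hp => hA.inter_nonempty_of_lt hUc hpq hp).sdiff
    (finite_iUnion hfin₁).isClosed
  have hcover : V ⊆ O₁ ∪ O₂ := by
    intro x hx
    obtain ⟨p, hp⟩ := hA.exists_mem x
    by_cases h1 : x ∈ ⋃ p, W₁ p
    · obtain ⟨q, hq⟩ := mem_iUnion.1 h1
      obtain rfl := hA.eq_of_mem hp (hW₁ q hq).2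
      refine Or.inl ⟨mem_iUnion₂.2 ⟨p, (hne₁ p).1 ⟨x, hq⟩, hp⟩, fun h2 => ?_⟩
      obtain ⟨q, hq'⟩ := mem_iUnion.1 h2
      exact disjoint_left.1 (hdisj' p q) hq hq'
    by_cases h2 : x ∈ ⋃ p, W₂ p
    · obtain ⟨q, hq⟩ := mem_iUnion.1 h2
      obtain rfl := hA.eq_of_mem hp (hW₂ q hq).2
      exact Or.inr ⟨mem_iUnion₂.2 ⟨p, (hne₂ p).1 ⟨x, hq⟩, hp⟩, h1⟩
    have hxp : (V ∩ A p).encard ≠ 0 := encard_ne_zero.2 ⟨x, hx, hp⟩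
    rw [hsum] at hxp
    by_cases h3 : p ∈ T₁
    · exact Or.inl ⟨mem_iUnion₂.2 ⟨p, h3, hp⟩, h2⟩
    · refine Or.inr ⟨mem_iUnion₂.2 ⟨p, ?_, hp⟩, h1⟩
      refine encard_ne_zero.1 fun h4 => hxp ?_
      rw [h4, add_zero]
      exact encard_eq_zero.2 (not_nonempty_iff_eq_empty.1 h3)
  obtain ⟨d, hd₁, hd₂⟩ := exists_basicOpen_between ((isCompact_basicOpen K).diff hO₂)
    (hO₁.inter (isOpen_basicOpen K))
    (fun x hx => ⟨(hcover (hKV hx.1)).resolve_right hx.2, hx.1⟩)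
  have hdV : basicOpen d ⊆ V := fun x hx => hKV (hd₂ hx).2
  have hW₁d : ∀ p, W₁ p ⊆ basicOpen d := fun p x hx =>
    hd₁ ⟨hWK₁ p hx, fun h => h.2 (mem_iUnion.2 ⟨p, hx⟩)⟩
  have hW₂d : ∀ p, ∀ x ∈ W₂ p, x ∉ basicOpen d := fun p x hx hxd =>
    (hd₂ hxd).1.2 (mem_iUnion.2 ⟨p, hx⟩)
  refine ⟨d, hdV, fun p => ?_⟩
  rcases hfc p with hp | hp
  · obtain ⟨hW, hc₁, hc₂⟩ := hfin p (hp.subset inter_subset_right)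
    rw [← hc₁, ← hc₂]
    constructor <;> congr 1 <;> ext x
    · refine ⟨fun hx => ⟨hW₁d p hx, (hW₁ p hx).2⟩, fun hx => ?_⟩
      have : x ∈ W₁ p ∪ W₂ p := hW ▸ ⟨hdV hx.1, hx.2⟩
      exact this.resolve_right fun h => hW₂d p x h hx.1
    · refine ⟨fun hx => ⟨⟨(hW₂ p hx).1, hW₂d p x hx⟩, (hW₂ p hx).2⟩, fun hx => ?_⟩
      have : x ∈ W₁ p ∪ W₂ p := hW ▸ ⟨hx.1.1, hx.2⟩
      exact this.resolve_left fun h => hx.1.2 (hW₁d p h)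
  · constructor
    · refine hp.encard_inter_congr (isOpen_basicOpen c) (isOpen_basicOpen d) ⟨fun h => ?_, ?_⟩
      · obtain ⟨x, hx⟩ := (hne₁ p).2 h
        exact ⟨x, hW₁d p hx, (hW₁ p hx).2⟩
      · rintro ⟨x, hxd, hxp⟩
        obtain ⟨q, hq, hxq⟩ := mem_iUnion₂.1 (hd₂ hxd).1.1
        obtain rfl := hA.eq_of_mem hxp hxq
        exact hq
    · refine hp.encard_inter_congr hUc (hV.sdiff (isClosed_basicOpen d)) ⟨fun h => ?_, ?_⟩
      · obtain ⟨x, hx⟩ := (hne₂ p).2 h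
        exact ⟨x, ⟨(hW₂ p hx).1, hW₂d p x hx⟩, (hW₂ p hx).2⟩
      · rintro ⟨x, ⟨hxV, hxd⟩, hxp⟩
        by_cases hxK : x ∈ basicOpen K
        · have hxO : x ∈ O₂ := by_contra fun h => hxd (hd₁ ⟨hxK, h⟩)
          obtain ⟨q, hq, hxq⟩ := mem_iUnion₂.1 hxO.1
          obtain rfl := hA.eq_of_mem hxp hxq
          exact hq
        · exact hres p ⟨x, ⟨hxV, fun h => hxK (hK ▸ Or.inl h)⟩, hxp⟩

end StoneSpace

/-! ### Tuples of compact open sets and the cells they define -/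

namespace StoneSpace

variable {R : Type u} [NonUnitalRing R] {P : Type v} {lt : P → P → Prop}
  {A : P → Set (StoneSpace R)} {ι : Type w}

/-- The cell that the sign pattern `s` defines for the tuple of the compact open sets `a i`,
`i ∈ F`: the points that lie in those with `i ∈ s` and outside the others. -/
def cell (F : Finset ι) (a : ι → R) (s : Set ι) : Set (StoneSpace R) :=
  {x | ∀ i ∈ F, x ∈ basicOpen (a i) ↔ i ∈ s}

theorem isClopen_cell (F : Finset ι) (a : ι → R) (s : Set ι) : IsClopen (cell F a s) := by
  classical
  have : cell F a s = ⋂ i ∈ F, if i ∈ s then basicOpen (a i) else (basicOpen (a i))ᶜ := by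
    ext x
    simp only [cell, mem_ofPred_eq, mem_iInter]
    refine forall₂_congr fun i _ => ?_
    split_ifs with h <;> simp [h]
  rw [this]
  refine isClopen_biInter_finset fun i _ => ?_
  split_ifs
  · exact ⟨isClosed_basicOpen _, isOpen_basicOpen _⟩
  · exact IsClopen.compl ⟨isClosed_basicOpen _, isOpen_basicOpen _⟩

theorem cell_congr {F : Finset ι} {a : ι → R} {s t : Set ι} (h : ∀ i ∈ F, i ∈ s ↔ i ∈ t) :
    cell F a s = cell F a t := by
  ext x
  exact forall₂_congr fun i hi => by rw [h i hi]

theorem cell_insert_of_mem [DecidableEq ι] {F : Finset ι} {a : ι → R} {s : Set ι} {i : ι}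
    (hi : i ∈ s) : cell (insert i F) a s = cell F a s ∩ basicOpen (a i) := by
  ext x
  simp only [cell, mem_ofPred_eq, Finset.forall_mem_insert, mem_inter_iff, hi, iff_true]
  exact and_comm

theorem cell_insert_of_notMem [DecidableEq ι] {F : Finset ι} {a : ι → R} {s : Set ι} {i : ι}
    (hi : i ∉ s) : cell (insert i F) a s = cell F a s \ basicOpen (a i) := by
  ext x
  simp only [cell, mem_ofPred_eq, Finset.forall_mem_insert, mem_sdiff, hi, iff_false]
  exact and_comm

/-- Two tuples of compact open sets are alike if corresponding cells meet all parts of the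
partition in equally many points. -/
def Alike (A : P → Set (StoneSpace R)) (F : Finset ι) (a b : ι → R) : Prop :=
  ∀ (s : Set ι) (p : P), (cell F a s ∩ A p).encard = (cell F b s ∩ A p).encard

theorem Alike.symm {F : Finset ι} {a b : ι → R} (h : Alike A F a b) : Alike A F b a :=
  fun s p => (h s p).symm

theorem Alike.of_insert [DecidableEq ι] {F : Finset ι} {a b : ι → R} {i : ι}
    (h : Alike A (insert i F) a b) : Alike A F a b := by
  intro s p
  by_cases hi : i ∈ F
  · simpa only [Finset.insert_eq_of_mem hi] using h s p
  have key : ∀ a : ι → R, (cell F a s ∩ A p).encard =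
      (cell (insert i F) a (insert i s) ∩ A p).encard +
        (cell (insert i F) a (s \ {i}) ∩ A p).encard := by
    intro a
    have h1 : cell F a (insert i s) = cell F a s := cell_congr fun j hj => by
      have : j ≠ i := fun h => hi (h ▸ hj)
      simp [this]
    have h2 : cell F a (s \ {i}) = cell F a s := cell_congr fun j hj => by
      have : j ≠ i := fun h => hi (h ▸ hj)
      simp [this]
    rw [cell_insert_of_mem (mem_insert i s), cell_insert_of_notMem (by simp), h1, h2,
      ← encard_union_eq, ← union_inter_distrib_right, inter_union_sdiff]
    exact disjoint_sdiff_inter.symm.mono inter_subset_left inter_subset_left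
  rw [key, key, h, h]

theorem Alike.mono [DecidableEq ι] {F G : Finset ι} {a b : ι → R} (h : Alike A F a b)
    (hGF : G ⊆ F) : Alike A G a b := by
  have key : ∀ H : Finset ι, Alike A (H ∪ G) a b → Alike A G a b := by
    intro H
    induction H using Finset.induction_on with
    | empty => simp
    | insert i H _ ih =>
      intro h
      rw [Finset.insert_union] at h
      exact ih h.of_insert
  exact key F (by rwa [Finset.union_eq_left.2 hGF])

/-- If two tuples are alike, then each point realizes the same sign pattern in the second tuple as
some point of the same part does in the first. -/
theorem Alike.exists_point {F : Finset ι} {a b : ι → R} (h : Alike A F a b) {p : P}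
    {y : StoneSpace R} (hy : y ∈ A p) :
    ∃ x ∈ A p, ∀ i ∈ F, x ∈ basicOpen (a i) ↔ y ∈ basicOpen (b i) := by
  have h1 : (cell F b {i | y ∈ basicOpen (b i)} ∩ A p).encard ≠ 0 :=
    encard_ne_zero.2 ⟨y, fun i _ => Iff.rfl, hy⟩
  rw [← h] at h1
  obtain ⟨x, hx, hxp⟩ := encard_ne_zero.1 h1
  exact ⟨x, hxp, hx⟩

theorem exists_basicOpen_eq_biUnion {κ : Type*} (S : Finset κ) (d : κ → R) :
    ∃ n : R, basicOpen n = ⋃ i ∈ S, basicOpen (d i) :=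
  exists_eq_basicOpen (S.isCompact_biUnion fun _ _ => isCompact_basicOpen _)
    (isOpen_biUnion fun _ _ => isOpen_basicOpen _)

/-- There is a compact open set outside which only those parts occur that are not contained in
any compact set. -/
theorem exists_minimal_residue [Finite P] (A : P → Set (StoneSpace R)) :
    ∃ k : R, ∀ (l : R) (p : P), ((basicOpen k)ᶜ ∩ A p).Nonempty →
      ((basicOpen l)ᶜ ∩ A p).Nonempty := by
  let t : R → Set P := fun k => {p | ((basicOpen k)ᶜ ∩ A p).Nonempty}
  obtain ⟨_, ⟨⟨k, rfl⟩, hk⟩⟩ := (toFinite (range t)).exists_minimal ⟨_, 0, rfl⟩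
  refine ⟨k, fun l p hp => ?_⟩
  have hle : t (k + l + k * l) ⊆ t k := by
    rintro q ⟨x, hx, hq⟩
    rw [basicOpen_add_add_mul] at hx
    exact ⟨x, fun h => hx (Or.inl h), hq⟩
  obtain ⟨x, hx, hxp⟩ := hk ⟨_, rfl⟩ hle hp
  rw [basicOpen_add_add_mul] at hx
  exact ⟨x, fun h => hx (Or.inr h), hxp⟩

/-- The extension property: for a finite-crowded partition, if `a` and `b` are alike, then each
element `m` has a counterpart `n` such that `a` with `m` and `b` with `n` are alike. -/
theorem Alike.exists_extension [Finite P] (hA : IsCompletePartition lt A)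
    (hfc : ∀ p, (A p).Finite ∨ Preperfect (A p)) {F : Finset ι} {a b : ι → R}
    (h : Alike A F a b) (m : R) :
    ∃ n : R, ∀ (s : Set ι) (p : P),
      ((cell F a s ∩ basicOpen m) ∩ A p).encard = ((cell F b s ∩ basicOpen n) ∩ A p).encard ∧
      ((cell F a s \ basicOpen m) ∩ A p).encard = ((cell F b s \ basicOpen n) ∩ A p).encard := by
  classical
  have hd : ∀ s : Finset ι, ∃ d : R, s ⊆ F → basicOpen d ⊆ cell F b s ∧ ∀ p,
      ((cell F a s ∩ basicOpen m) ∩ A p).encard = (basicOpen d ∩ A p).encard ∧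
      ((cell F a s \ basicOpen m) ∩ A p).encard = ((cell F b s \ basicOpen d) ∩ A p).encard := by
    intro s
    by_cases hsF : s ⊆ F
    swap
    · exact ⟨0, fun h => absurd h hsF⟩
    have hoa := isClopen_cell F a s
    have hob := isClopen_cell F b s
    obtain ⟨c, hc⟩ := exists_eq_basicOpen ((isCompact_basicOpen m).inter_left hoa.1)
      (hoa.2.inter (isOpen_basicOpen m))
    obtain ⟨k, hk, hres⟩ : ∃ k : R, basicOpen k ⊆ cell F b s ∧
        ∀ p, ((cell F b s \ basicOpen k) ∩ A p).Nonempty →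
          ((cell F a s \ basicOpen c) ∩ A p).Nonempty := by
      rcases s.eq_empty_or_nonempty with rfl | ⟨i, hi⟩
      · -- the only cell that may fail to be compact
        obtain ⟨k₀, hk₀⟩ := exists_minimal_residue A
        obtain ⟨k, hk⟩ := exists_eq_basicOpen ((isCompact_basicOpen k₀).inter_left hob.1)
          (hob.2.inter (isOpen_basicOpen k₀))
        refine ⟨k, hk ▸ inter_subset_left, ?_⟩
        rintro p ⟨x, ⟨hx1, hx2⟩, hxp⟩
        obtain ⟨l, hl⟩ := exists_basicOpen_eq_biUnion F a
        have hx : x ∈ (basicOpen k₀)ᶜ := fun h => hx2 (hk ▸ ⟨hx1, h⟩)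
        obtain ⟨y, hy, hyp⟩ := hk₀ (l + c + l * c) p ⟨x, hx, hxp⟩
        rw [basicOpen_add_add_mul, hl] at hy
        refine ⟨y, ⟨fun i hi => ?_, fun h => hy (Or.inr h)⟩, hyp⟩
        simp only [Finset.coe_empty, mem_empty_iff_false, iff_false]
        exact fun h => hy (Or.inl (mem_iUnion₂.2 ⟨i, hi, h⟩))
      · have hsub : cell F b s ⊆ basicOpen (b i) := fun x hx => (hx i (hsF hi)).2 hi
        obtain ⟨k, hk⟩ := exists_eq_basicOpen
          ((isCompact_basicOpen (b i)).of_isClosed_subset hob.1 hsub) hob.2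
        refine ⟨k, hk.subset, fun p => ?_⟩
        rw [hk, sdiff_self]
        simp
    obtain ⟨d, hd, hd'⟩ := exists_split hA hfc hoa.2 hob.2 (h s) (hc ▸ inter_subset_left) hk hres
    refine ⟨d, fun _ => ⟨hd, fun p => ?_⟩⟩
    rw [← (hd' p).2, ← (hd' p).1, hc, sdiff_self_inter]
    exact ⟨rfl, rfl⟩
  choose d hd using hd
  obtain ⟨n, hn⟩ := exists_basicOpen_eq_biUnion F.powerset d
  refine ⟨n, fun s p => ?_⟩
  let t := F.filter (· ∈ s)
  have htF : t ⊆ F := Finset.filter_subset _ _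
  have hst : ∀ a : ι → R, cell F a s = cell F a t := fun a => cell_congr fun i hi => by
    simp [t, hi]
  have hcell : cell F b t ∩ basicOpen n = basicOpen (d t) := by
    ext x
    refine ⟨fun ⟨hx, hxn⟩ => ?_, fun hx => ⟨(hd t htF).1 hx, ?_⟩⟩
    · rw [hn] at hxn
      obtain ⟨t', ht', hxt'⟩ := mem_iUnion₂.1 hxn
      have ht'F := Finset.mem_powerset.1 ht'
      have hx' := (hd t' ht'F).1 hxt'
      have : t = t' := by
        ext i
        by_cases hi : i ∈ F
        · exact (hx i hi).symm.trans (hx' i hi)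
        · exact ⟨fun h => absurd (htF h) hi, fun h => absurd (ht'F h) hi⟩
      rwa [this]
    · rw [hn]
      exact mem_iUnion₂.2 ⟨t, Finset.mem_powerset.2 htF, hx⟩
  rw [hst a, hst b, ← sdiff_self_inter (s := cell F b t), hcell]
  exact (hd t htF).2 p

end StoneSpace

/-! ### Automorphisms for a finite-crowded partition -/

namespace StoneSpace

variable {R : Type u} [NonUnitalRing R] {P : Type v} {lt : P → P → Prop}
  {A : P → Set (StoneSpace R)}

/-- Alike tuples are conjugate under an automorphism of the ring with its distinguished ideals. -/
theorem exists_automorphism [Countable R] (hR : ∀ a : R, a * a = a) [Finite P]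
    (hA : IsCompletePartition lt A) (hfc : ∀ p, (A p).Finite ∨ Preperfect (A p))
    (F₀ : Finset (R × R)) (h₀ : Alike A F₀ Prod.fst Prod.snd) :
    ∃ e : R ≃ R, (∀ x ∈ F₀, e x.1 = x.2) ∧ (∀ a b, e (a + b) = e a + e b) ∧
      (∀ a b, e (a * b) = e a * e b) ∧
      ∀ p a, (basicOpen (e a) ∩ A p).Nonempty ↔ (basicOpen a ∩ A p).Nonempty := by
  classical
  have hcell : ∀ (F : Finset (R × R)) (m n : R),
      (∀ (s : Set (R × R)) (p : P),
        ((cell F Prod.fst s ∩ basicOpen m) ∩ A p).encard =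
          ((cell F Prod.snd s ∩ basicOpen n) ∩ A p).encard ∧
        ((cell F Prod.fst s \ basicOpen m) ∩ A p).encard =
          ((cell F Prod.snd s \ basicOpen n) ∩ A p).encard) →
      Alike A (insert (m, n) F) Prod.fst Prod.snd := by
    intro F m n h s p
    by_cases hs : (m, n) ∈ s
    · rw [cell_insert_of_mem hs, cell_insert_of_mem hs]
      exact (h s p).1
    · rw [cell_insert_of_notMem hs, cell_insert_of_notMem hs]
      exact (h s p).2
  have hinj : ∀ (F : Finset (R × R)) (a b : R × R → R), Alike A F a b →
      ∀ x ∈ F, ∀ y ∈ F, a x = a y → b x = b y := by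
    intro F a b hF x hx y hy hxy
    refine basicOpen_injective hR (Set.ext fun z => ?_)
    obtain ⟨p, hp⟩ := hA.exists_mem z
    obtain ⟨z', -, hz'⟩ := hF.exists_point hp
    rw [← hz' x hx, ← hz' y hy, hxy]
  obtain ⟨e, he₀, he⟩ := exists_equiv_of_back_and_forth
    (fun F : Finset (R × R) => Alike A F Prod.fst Prod.snd) (fun F G hF hGF => hF.mono hGF)
    (fun F hF x hx y hy => ⟨hinj F _ _ hF x hx y hy, hinj F _ _ hF.symm x hx y hy⟩)
    (fun F hF m => by
      obtain ⟨n, hn⟩ := hF.exists_extension hA hfc m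
      exact ⟨n, hcell F m n hn⟩)
    (fun F hF n => by
      obtain ⟨m, hm⟩ := hF.symm.exists_extension hA hfc n
      exact ⟨m, hcell F m n fun s p => ⟨(hm s p).1.symm, (hm s p).2.symm⟩⟩)
    F₀ h₀
  have hpt : ∀ (F : Finset R) (y : StoneSpace R), ∃ x : StoneSpace R,
      ∀ a ∈ F, x ∈ basicOpen a ↔ y ∈ basicOpen (e a) := by
    intro F y
    obtain ⟨p, hp⟩ := hA.exists_mem y
    obtain ⟨x, -, hx⟩ := (he F).exists_point hp
    exact ⟨x, fun a ha => hx _ (Finset.mem_image_of_mem _ ha)⟩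
  refine ⟨e, he₀, fun a b => ?_, fun a b => ?_, fun p a => ⟨?_, ?_⟩⟩
  · refine basicOpen_injective hR (Set.ext fun y => ?_)
    obtain ⟨x, hx⟩ := hpt {a, b, a + b} y
    rw [mem_basicOpen_add, ← hx _ (by simp), ← hx a (by simp), ← hx b (by simp),
      mem_basicOpen_add]
  · refine basicOpen_injective hR (Set.ext fun y => ?_)
    obtain ⟨x, hx⟩ := hpt {a, b, a * b} y
    rw [mem_basicOpen_mul, ← hx _ (by simp), ← hx a (by simp), ← hx b (by simp),
      mem_basicOpen_mul]
  · rintro ⟨y, hy, hyp⟩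
    obtain ⟨x, hxp, hx⟩ := (he {a}).exists_point hyp
    exact ⟨x, (hx (a, e a) (by simp)).2 hy, hxp⟩
  · rintro ⟨y, hy, hyp⟩
    obtain ⟨x, hxp, hx⟩ := (he {a}).symm.exists_point hyp
    exact ⟨x, (hx (a, e a) (by simp)).2 hy, hxp⟩

/-- A part of a finite-crowded partition meets open sets in finitely many possible numbers of
points. -/
theorem finite_range_encard {C : Set (StoneSpace R)} (hC : C.Finite ∨ Preperfect C) :
    {n : ℕ∞ | ∃ U : Set (StoneSpace R), IsOpen U ∧ (U ∩ C).encard = n}.Finite := by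
  rcases hC with hC | hC
  · obtain ⟨m, hm⟩ := ENat.ne_top_iff_exists.1 hC.encard_lt_top.ne
    refine ((finite_Iic m).image ((↑) : ℕ → ℕ∞)).subset ?_
    rintro _ ⟨U, -, rfl⟩
    have hle : (U ∩ C).encard ≤ m := hm ▸ encard_le_encard inter_subset_right
    obtain ⟨k, hk⟩ := ENat.ne_top_iff_exists.1 (ne_top_of_le_ne_top (by simp) hle)
    rw [← hk] at hle ⊢
    exact ⟨k, by simpa using hle, rfl⟩
  · refine (toFinite ({0, ⊤} : Set ℕ∞)).subset ?_
    rintro _ ⟨U, hU, rfl⟩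
    by_cases h : (U ∩ C).Nonempty
    · exact Or.inr (hC.encard_inter_eq_top hU h)
    · exact Or.inl (encard_eq_zero.2 (not_nonempty_iff_eq_empty.1 h))

theorem isAlmostTransitive_of_finiteCrowded [Countable R] (hR : ∀ a : R, a * a = a) [Finite P]
    (hA : IsCompletePartition lt A) (hfc : ∀ p, (A p).Finite ∨ Preperfect (A p)) (r : ℕ) :
    IsAlmostTransitive (idealLanguage P) (IdealSystem R fun p => idealOf (closure (A p))) r := by
  classical
  let τ : (Fin r → R) → Set (Fin r) → P → ℕ∞ :=
    fun a s p => (cell Finset.univ a s ∩ A p).encard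
  have hτ : (range τ).Finite := by
    refine (Set.Finite.pi' fun _ : Set (Fin r) => Set.Finite.pi' fun p =>
      finite_range_encard (hfc p)).subset ?_
    rintro _ ⟨a, rfl⟩ s p
    exact ⟨_, (isClopen_cell _ _ _).2, rfl⟩
  obtain ⟨S, hS, hSτ⟩ : ∃ S : Set (Fin r → R), S.Finite ∧ ∀ a, ∃ b ∈ S, τ b = τ a := by
    choose f hf using fun t : range τ => t.2
    have : Finite (range τ) := hτ
    exact ⟨range f, finite_range f, fun a => ⟨_, ⟨⟨τ a, a, rfl⟩, rfl⟩, hf _⟩⟩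
  refine ⟨S, hS, fun (a : Fin r → R) => ?_⟩
  obtain ⟨b, hb, hba⟩ := hSτ a
  refine ⟨b, hb, ?_⟩
  let F₀ : Finset (R × R) := Finset.univ.image fun i => (b i, a i)
  have h₀ : Alike A F₀ Prod.fst Prod.snd := by
    intro s p
    convert congrFun (congrFun hba {i | (b i, a i) ∈ s}) p using 3
    · ext x
      simp [cell, F₀]
    · ext x
      simp [cell, F₀]
  obtain ⟨e, he₀, hadd, hmul, hmem⟩ := exists_automorphism hR hA hfc F₀ h₀
  have hzero : e 0 = 0 := by simpa using hadd 0 0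
  have hmem' : ∀ p c, e c ∈ idealOf (closure (A p)) ↔ c ∈ idealOf (closure (A p)) := fun p c => by
    rw [mem_idealOf_closure, mem_idealOf_closure, hmem]
  refine ⟨⟨e, ?_, ?_⟩, fun i => he₀ (b i, a i) (Finset.mem_image_of_mem _ (Finset.mem_univ i))⟩
  · rintro n (_ | _ | _) x
    · exact hzero
    · exact hadd _ _
    · exact hmul _ _
  · rintro n ⟨p⟩ x
    exact hmem' p _

end StoneSpace

/-! ### Partitions of structures with finitely many types -/

namespace StoneSpace

variable {R : Type u} [NonUnitalRing R] {P : Type v} {lt : P → P → Prop}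
  {A : P → Set (StoneSpace R)}

/-- If `C` has no limit points of its own, then a finite subset of `C` can be cut out of `C` by a
compact open subset of a given neighbourhood. -/
theorem exists_basicOpen_inter_eq {C : Set (StoneSpace R)} (hC : ∀ x ∈ C, x ∉ derivedSet C)
    {W : Set (StoneSpace R)} (hW : W.Finite) (hWC : W ⊆ C) {U : Set (StoneSpace R)}
    (hU : IsOpen U) (hWU : W ⊆ U) : ∃ a, basicOpen a ⊆ U ∧ basicOpen a ∩ C = W := by
  obtain ⟨a, h1, h2⟩ := exists_basicOpen_between hW.isCompact
    (hU.sdiff (isClosed_closure (s := C \ W))) (fun x hx => ⟨hWU hx, fun h => hC x (hWC hx) <| by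
      rw [mem_derivedSet, accPt_principal_iff_clusterPt, ← mem_closure_iff_clusterPt]
      exact closure_mono (s := C \ W) (t := C \ {x})
        (fun y hy => ⟨hy.1, fun hyx => hy.2 (hyx ▸ hx)⟩) h⟩)
  refine ⟨a, fun x hx => (h2 hx).1, Subset.antisymm ?_ fun x hx => ⟨h1 hx, hWC hx⟩⟩
  rintro x ⟨hxa, hxC⟩
  by_contra hxW
  exact (h2 hxa).2 (subset_closure ⟨hxC, hxW⟩)

/-- A first-order formula that says that a compact open set does not belong to the ideal of `p`. -/
def meetsFormula (p : P) : (idealLanguage P).Formula (Fin 1) :=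
  (FirstOrder.Language.Relations.formula (L := idealLanguage P) (IdealRel.mem p)
    fun _ : Fin 1 => FirstOrder.Language.Term.var 0).not

theorem realize_meetsFormula {p : P}
    {v : Fin 1 → IdealSystem R fun p => idealOf (closure (A p))} :
    (meetsFormula p).Realize v ↔ (basicOpen (R := R) (v 0) ∩ A p).Nonempty := by
  refine FirstOrder.Language.Formula.realize_not.trans ?_
  refine Iff.trans (not_congr FirstOrder.Language.Formula.realize_rel) ?_
  exact not_iff_comm.1 mem_idealOf_closure.symm

/-- First-order formulas that say that a compact open set has at least `n` disjoint subsets outside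
the ideal of `p`: there is a subset `b` of `a` that meets the part of `p`, and the formula for
`n - 1` holds of `a \ b`, which is the ring element `a + b`. -/
noncomputable def countFormula (p : P) : ℕ → (idealLanguage P).Formula (Fin 1)
  | 0 => ⊤
  | n + 1 =>
    let x : (idealLanguage P).Term (Fin 1 ⊕ Fin 1) := .var (.inl 0)
    let y : (idealLanguage P).Term (Fin 1 ⊕ Fin 1) := .var (.inr 0)
    ((FirstOrder.Language.Term.equal (.func (l := 2) RngFunc.mul ![x, y]) y ⊓
        (meetsFormula p).relabel Sum.inr) ⊓
      FirstOrder.Language.BoundedFormula.subst (countFormula p n)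
        fun _ => .func (l := 2) RngFunc.add ![x, y] : (idealLanguage P).Formula _).iExs (Fin 1)

theorem realize_countFormula [Countable R] (hR : ∀ a : R, a * a = a) {p : P}
    (hp : ∀ x ∈ A p, x ∉ derivedSet (A p)) (n : ℕ)
    (v : Fin 1 → IdealSystem R fun p => idealOf (closure (A p))) :
    (countFormula p n).Realize v ↔ n ≤ (basicOpen (R := R) (v 0) ∩ A p).encard := by
  induction n generalizing v with
  | zero => exact iff_of_true (FirstOrder.Language.BoundedFormula.realize_top.2 trivial) (by simp)
  | succ n ih =>
    obtain ⟨a, rfl⟩ : ∃ a : R, v = fun _ => a :=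
      ⟨v 0, funext fun j => congrArg v (Subsingleton.elim j 0)⟩
    have hrec : (countFormula p (n + 1)).Realize
          (M := IdealSystem R fun p => idealOf (closure (A p))) (fun _ => a) ↔
        ∃ b : R, (a * b = b ∧ (basicOpen b ∩ A p).Nonempty) ∧
          (n : ℕ∞) ≤ (basicOpen (a + b) ∩ A p).encard := by
      refine FirstOrder.Language.Formula.realize_iExs.trans (Iff.trans (exists_congr fun u => ?_)
        (b := ∃ u : Fin 1 → R, (a * u 0 = u 0 ∧ (basicOpen (u 0) ∩ A p).Nonempty) ∧
          (n : ℕ∞) ≤ (basicOpen (a + u 0) ∩ A p).encard)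
        ⟨fun ⟨u, hu⟩ => ⟨u 0, hu⟩, fun ⟨b, hb⟩ => ⟨fun _ => b, hb⟩⟩)
      refine FirstOrder.Language.Formula.realize_inf.trans (and_congr
        (FirstOrder.Language.Formula.realize_inf.trans (and_congr
          (FirstOrder.Language.Formula.realize_equal.trans Iff.rfl)
          (FirstOrder.Language.Formula.realize_relabel.trans realize_meetsFormula))) ?_)
      exact FirstOrder.Language.BoundedFormula.realize_subst.trans (ih _)
    rw [hrec]
    push_cast
    constructor
    · rintro ⟨b, ⟨hb, hbp⟩, hn⟩
      have hsub : basicOpen b ⊆ basicOpen (a) := by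
        rw [← hb, basicOpen_mul]
        exact inter_subset_left
      have hadd : basicOpen (a + b) = basicOpen (a) \ basicOpen b := by
        rw [← basicOpen_add_mul, hb]
      rw [← union_sdiff_cancel hsub, ← hadd, union_inter_distrib_right, encard_union_eq, add_comm]
      · exact add_le_add (one_le_encard_iff_nonempty.2 hbp) hn
      · rw [hadd]
        exact disjoint_sdiff_right.mono inter_subset_left inter_subset_left
    · intro hn
      obtain ⟨x, hxa, hxp⟩ : (basicOpen (a) ∩ A p).Nonempty :=
        one_le_encard_iff_nonempty.1 (le_trans (by simp) hn)
      obtain ⟨b, hba, hbp⟩ := exists_basicOpen_inter_eq hp (finite_singleton x)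
        (singleton_subset_iff.2 hxp) (isOpen_basicOpen (a)) (singleton_subset_iff.2 hxa)
      have hb : a * b = b := basicOpen_injective hR <| by
        rw [basicOpen_mul, inter_eq_right.2 hba]
      refine ⟨b, ⟨hb, hbp ▸ singleton_nonempty x⟩, ?_⟩
      have h2 : basicOpen (a + b) ∩ A p = (basicOpen (a) ∩ A p) \ {x} := by
        rw [← hb, basicOpen_add_mul, ← hbp]
        ext y
        simp only [mem_inter_iff, mem_sdiff]
        tauto
      rw [h2]
      rw [← encard_sdiff_singleton_add_one (s := basicOpen a ∩ A p) ⟨hxa, hxp⟩] at hn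
      exact (WithTop.add_le_add_iff_right ENat.one_ne_top).1 hn

/-- If finitely many types of elements are realized, then the partition is finite-crowded: the
ideals of the parts have to be distinguished by finitely many elements, and an infinite part
without limit points of its own would allow infinitely many values of `(basicOpen a ∩ A p).encard`,
which depends only on the type of `a`. -/
theorem finiteCrowded_of_hasFinitelyManyTypes [Countable R] (hR : ∀ a : R, a * a = a)
    (hP : IsPOSystem lt) (hA : IsCompletePartition lt A)
    (h : HasFinitelyManyTypes (idealLanguage P)
      (IdealSystem R fun p => idealOf (closure (A p))) (Fin 1)) :
    Finite P ∧ ∀ p, (A p).Finite ∨ Preperfect (A p) := by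
  obtain ⟨S, hS, h⟩ := h
  have : Finite S := hS
  have hmeets : ∀ (v : Fin 1 → R), ∃ b ∈ S, ∀ p,
      (basicOpen (R := R) (b 0) ∩ A p).Nonempty ↔ (basicOpen (v 0) ∩ A p).Nonempty := fun v => by
    obtain ⟨b, hb, hbv⟩ := h v
    refine ⟨b, hb, fun p => ?_⟩
    exact realize_meetsFormula.symm.trans ((hbv (meetsFormula p)).trans realize_meetsFormula)
  constructor
  · let t : P → Set S := fun p => {b | (basicOpen (R := R) (b.1 0) ∩ A p).Nonempty}
    have hle : ∀ p q, t p = t q → p = q ∨ lt p q := by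
      intro p q hpq
      obtain ⟨x, hx⟩ := hA.nonempty p
      refine (hA.mem_closure_iff hx).1
        (isTopologicalBasis_basicOpen.mem_closure_iff.2 ?_)
      rintro _ ⟨a, rfl⟩ hxa
      obtain ⟨b, hb, hba⟩ := hmeets fun _ => a
      have h1 : (⟨b, hb⟩ : S) ∈ t p := (hba p).2 ⟨x, hxa, hx⟩
      rw [hpq] at h1
      exact (hba q).1 h1
    refine Finite.of_injective t fun p q hpq => ?_
    rcases hle p q hpq with h1 | h1
    · exact h1
    rcases hle q p hpq.symm with h2 | h2
    · exact h2.symm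
    exact hP.antisymm p q h1 h2
  · intro p
    by_cases hpp : lt p p
    · exact Or.inr (hA.preperfect_of_lt_self hpp)
    left
    by_contra hinf
    have hlim : ∀ x ∈ A p, x ∉ derivedSet (A p) := fun x hx => hA.notMem_derivedSet hpp hx
    have hval : range ((↑) : ℕ → ℕ∞) ⊆
        (fun b : Fin 1 → R => (basicOpen (b 0) ∩ A p).encard) '' S := by
      rintro _ ⟨n, rfl⟩
      obtain ⟨W, hWp, hW⟩ := (show (A p).Infinite from hinf).exists_subset_card_eq n
      obtain ⟨a, -, ha⟩ := exists_basicOpen_inter_eq hlim W.finite_toSet hWp isOpen_univ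
        (subset_univ _)
      obtain ⟨b, hb, hba⟩ := h fun _ => a
      refine ⟨b, hb, ?_⟩
      have hk : ∀ k : ℕ, (k : ℕ∞) ≤ (basicOpen (R := R) (b 0) ∩ A p).encard ↔ k ≤ n := by
        intro k
        refine (realize_countFormula hR hlim k b).symm.trans ((hba (countFormula p k)).trans
          ((realize_countFormula hR hlim k _).trans ?_))
        rw [ha, encard_coe_eq_coe_finsetCard, hW]
        simp
      refine le_antisymm ?_ ((hk n).2 le_rfl)
      exact ENat.forall_natCast_le_iff_le.1 fun k hkb => by simpa using (hk k).1 hkb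
    exact (infinite_range_of_injective Nat.cast_injective) ((hS.image _).subset hval)

end StoneSpace

/-! ### The characterization -/

instance idealLanguage.countable_symbols {P : Type v} [Countable P] :
    Countable (idealLanguage P).Symbols := by
  have h1 : Function.Injective fun f : Σ n, RngFunc n =>
      (match f with | ⟨_, .zero⟩ => 0 | ⟨_, .add⟩ => 1 | ⟨_, .mul⟩ => 2 : ℕ) := by
    rintro ⟨_, _ | _ | _⟩ ⟨_, _ | _ | _⟩ h <;> simp_all
  have h2 : Function.Surjective fun p : P => (⟨1, .mem p⟩ : Σ n, IdealRel P n) := by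
    rintro ⟨_, ⟨p⟩⟩
    exact ⟨p, rfl⟩
  have := h1.countable
  have := h2.countable
  exact inferInstanceAs (Countable ((Σ n, RngFunc n) ⊕ Σ n, IdealRel P n))

theorem theorem1p2 {R : Type u} [NonUnitalRing R] [Countable R]
    (hR : ∀ a : R, a * a = a)
    {P : Type v} (lt : P → P → Prop) (hP : IsPOSystem lt)
    (A : P → Set (StoneSpace R)) (hA : IsCompletePartition lt A) :
    (Countable P →
      (IsOmegaCategorical (idealLanguage P)
          (IdealSystem R fun p => StoneSpace.idealOf (closure (A p))) ↔
        IsFiniteCrowded (Set.range A))) ∧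
    ((∀ r : ℕ, IsAlmostTransitive (idealLanguage P)
          (IdealSystem R fun p => StoneSpace.idealOf (closure (A p))) r) ↔
        IsFiniteCrowded (Set.range A)) := by
  let M := IdealSystem R fun p => StoneSpace.idealOf (closure (A p))
  have : Countable M := ‹Countable R›
  have : Nonempty M := ⟨(0 : R)⟩
  have hcrowded : Finite P ∧ (∀ p, (A p).Finite ∨ Preperfect (A p)) ↔
      IsFiniteCrowded (range A) := by
    constructor
    · rintro ⟨_, h⟩
      exact ⟨finite_range A, forall_mem_range.2 h⟩
    · rintro ⟨h1, h2⟩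
      have : Finite (range A) := h1
      exact ⟨(Finite.of_injective_finite_range hA.injective), forall_mem_range.1 h2⟩
  have htypes : HasFinitelyManyTypes (idealLanguage P) M (Fin 1) → IsFiniteCrowded (range A) :=
    fun h => hcrowded.1 (StoneSpace.finiteCrowded_of_hasFinitelyManyTypes hR hP hA h)
  have htrans : IsFiniteCrowded (range A) → ∀ r, IsAlmostTransitive (idealLanguage P) M r := by
    intro h
    obtain ⟨_, hfc⟩ := hcrowded.2 h
    exact StoneSpace.isAlmostTransitive_of_finiteCrowded hR hA hfc
  refine ⟨fun _ => ⟨fun h => htypes (IsOmegaCategorical.hasFinitelyManyTypes (M := M) h),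
    fun h => ?_⟩, fun h => htypes (IsAlmostTransitive.hasFinitelyManyTypes h _), htrans⟩
  exact isOmegaCategorical_of_hasFinitelyManyTypes (M := M) fun α _ =>
    IsAlmostTransitive.hasFinitelyManyTypes (htrans h) α
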